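/- Let $0\le k\le n$. For a field $F$, regard a $k$-plane $K\subset F^n$ as the row space of a $k\times n$ matrix; its Plücker coordinates $p_\alpha(K)$, for $\alpha\in\binom{[n]}{k}=\{1\le\alpha_1<\cdots<\alpha_k\le n\}$, are the maximal minors of this matrix, defined up to a common nonzero scalar. Order $\binom{[n]}{k}$ by the Bruhat order $\beta\le\alpha\iff\beta_j\le\alpha_j$ for all $j$, put $|\alpha|=\sum_j(\alpha_j-j)$, and let $d(\alpha)$ be the number of saturated chains in the Bruhat order from the minimal element $\hat 0=(1,2,\ldots,k)$ to $\alpha$. In the Grassmannian $\mathrm{Gr}(k,n)$ of complex $k$-planes in $\mathbb C^n$ let $$\Omega_\alpha=\{K : p_\beta(K)=0\text{ for all }\beta\not\le\alpha\},$$ and for an $(n-k)$-plane $M\subset\mathbb R^n$ let $\Omega(M)$ be the set of complex $k$-planes $K$ that meet the complexification of $M$ non-trivially. For $t\in\mathbb R^\times$ let $t.M$ be the image of $M$ under the linear map $e_j\mapsto t^j e_j$ ($j=1,\ldots,n$). Theorem. Let $L\subset\mathbb R^n$ be an $(n-k)$-plane none of whose Plücker coordinates vanishes. Then there are nonzero real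 numbers $t_1,\ldots,t_{k(n-k)}$ such that, for every $\alpha\in\binom{[n]}{k}$, the intersection $$\Omega_\alpha\cap\Omega(t_1.L)\cap\Omega(t_2.L)\cap\cdots\cap\Omega(t_{|\alpha|}.L)$$ in $\mathrm{Gr}(k,n)$ is transverse (at each of its points all the varieties involved are smooth, and the codimension of the intersection of their tangent spaces is the sum of their codimensions), it consists of exactly $d(\alpha)$ points, and each of these points is real, that is, the complexification of a $k$-plane in $\mathbb R^n$. -/

import Mathlib

namespace SchubertCalculus

/-- `binom([n], k)`: the strictly increasing sequences `α₁ < ⋯ < α_k` in `[n]` (numbered from `0`).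
Its order, inherited from the product order, is the Bruhat order `β ≤ α ↔ ∀ j, β_j ≤ α_j`. -/
abbrev PluckerIndex (k n : ℕ) : Type := {α : Fin k → Fin n // StrictMono α}

/-- `|α| = ∑_j (α_j - j)`. No subtraction truncates, since `α` is strictly increasing; the value
does not depend on whether one counts from `0` or from `1`. -/
def PluckerIndex.size {k n : ℕ} (α : PluckerIndex k n) : ℕ :=
  ∑ j : Fin k, ((α.1 j : ℕ) - (j : ℕ))

/-- `d(α)`: the number of saturated chains `0̂ = γ₀ ⋖ γ₁ ⋖ ⋯ ⋖ γ_r = α` in the Bruhat order from its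
minimal element to `α`. -/
noncomputable def chainCount {k n : ℕ} (α : PluckerIndex k n) : ℕ :=
  Set.ncard {c : List (PluckerIndex k n) |
    c.IsChain (· ⋖ ·) ∧ (∃ γ, IsBot γ ∧ c.head? = some γ) ∧ c.getLast? = some α}

section Grassmannian

variable {F : Type*} [Field F]

/-- The Grassmannian of `k`-dimensional subspaces of `Fⁿ`. -/
def Gr (F : Type*) [Field F] (k n : ℕ) : Set (Submodule F (Fin n → F)) :=
  {K | Module.finrank F K = k}

/-- The row space of a matrix. -/
def rowSpace {m n : ℕ} (A : Matrix (Fin m) (Fin n) F) : Submodule F (Fin n → F) :=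
  Submodule.span F (Set.range A.row)

/-- The maximal minor of `A` on the columns `α`. -/
def minor {m n : ℕ} (A : Matrix (Fin m) (Fin n) F) (α : PluckerIndex m n) : F :=
  (A.submatrix id α.1).det

/-- The Plücker coordinate `p_α(K)` of the `m`-plane `K` vanishes. The `m × n` matrices with row
space `K` differ by left multiplication by an invertible matrix, so that the vector of their
maximal minors is determined up to a nonzero scalar. -/
def PluckerVanishes {m n : ℕ} (K : Submodule F (Fin n → F)) (α : PluckerIndex m n) : Prop :=
  ∀ A : Matrix (Fin m) (Fin n) F, rowSpace A = K → minor A α = 0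

/-- The Schubert variety `Ω_α = {K ∈ Gr(k,n) | p_β(K) = 0 for all β ≰ α}`. -/
def schubertVariety {k n : ℕ} (F : Type*) [Field F] (α : PluckerIndex k n) :
    Set (Submodule F (Fin n → F)) :=
  {K | K ∈ Gr F k n ∧ ∀ β : PluckerIndex k n, ¬ β ≤ α → PluckerVanishes K β}

/-- The special Schubert variety `Ω(L)`: the `k`-planes that meet `L` non-trivially. -/
def specialSchubert {n : ℕ} (k : ℕ) (L : Submodule F (Fin n → F)) :
    Set (Submodule F (Fin n → F)) :=
  {K | K ∈ Gr F k n ∧ K ⊓ L ≠ ⊥}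

/-- The linear map `e_j ↦ t^j e_j` (`j = 1, …, n`) of `Fⁿ`. -/
def weightScaling (n : ℕ) (t : F) : (Fin n → F) →ₗ[F] (Fin n → F) :=
  LinearMap.pi fun j => t ^ ((j : ℕ) + 1) • LinearMap.proj j

end Grassmannian

/-- The complexification of a subspace of `ℝⁿ`: its `ℂ`-linear span in `ℂⁿ`. -/
def complexify {n : ℕ} (U : Submodule ℝ (Fin n → ℝ)) : Submodule ℂ (Fin n → ℂ) :=
  Submodule.span ℂ ((fun v : Fin n → ℝ => fun j => (v j : ℂ)) '' (U : Set (Fin n → ℝ)))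

/-- A subspace of `ℂⁿ` is real if it is the complexification of a subspace of `ℝⁿ`. -/
def IsRealPlane {n : ℕ} (K : Submodule ℂ (Fin n → ℂ)) : Prop :=
  ∃ U : Submodule ℝ (Fin n → ℝ), complexify U = K

section Transversality

/-- The differential at `p` of a polynomial function on `ℂ^σ`, as a row vector. -/
noncomputable def polyDifferential {σ : Type*} (f : MvPolynomial σ ℂ) (p : σ → ℂ) : σ → ℂ :=
  fun s => MvPolynomial.eval p (MvPolynomial.pderiv s f)

/-- The polynomials `f` cut out `S ⊆ ℂ^σ` near `p`, that is, on some principal Zariski open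
neighbourhood `{h ≠ 0}` of `p`. -/
def CutsOutNear {σ ι : Type*} (S : Set (σ → ℂ)) (p : σ → ℂ) (f : ι → MvPolynomial σ ℂ) : Prop :=
  ∃ h : MvPolynomial σ ℂ, MvPolynomial.eval p h ≠ 0 ∧
    ∀ x : σ → ℂ, MvPolynomial.eval x h ≠ 0 → (x ∈ S ↔ ∀ i, MvPolynomial.eval x (f i) = 0)

/-- The trace of a set `Y` of `k`-planes on an affine chart of the Grassmannian: if the rows of `A`
and of `C` are bases of complementary subspaces, `X ↦ rowSpace (A + X C)` is a bijection from the
`k × (n-k)` matrices to the open set of all `k`-planes complementary to `rowSpace C`; it takes `0`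
to `rowSpace A`. -/
def chartTrace {k n : ℕ} (A : Matrix (Fin k) (Fin n) ℂ) (C : Matrix (Fin (n - k)) (Fin n) ℂ)
    (Y : Set (Submodule ℂ (Fin n → ℂ))) : Set (Fin k × Fin (n - k) → ℂ) :=
  {x | rowSpace (A + Matrix.of (fun i j => x (i, j)) * C) ∈ Y}

/-- The sets `Y i` in the complex Grassmannian `Gr(k,n)` meet transversally at their common point
`K`: in every affine chart centered at `K`, each `Y i` is cut out near `K` by some number `c i` of
equations, and the differentials at `K` of all these equations, for all `i` together, are linearly
independent. In other words, each `Y i` is smooth at `K`, of codimension `c i` and with the common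
kernel of the differentials of its equations as tangent space, and the codimension of the
intersection of these tangent spaces is the sum of their codimensions. -/
def TransverseAt {ι : Type*} (k : ℕ) {n : ℕ} (Y : ι → Set (Submodule ℂ (Fin n → ℂ)))
    (K : Submodule ℂ (Fin n → ℂ)) : Prop :=
  ∀ (A : Matrix (Fin k) (Fin n) ℂ) (C : Matrix (Fin (n - k)) (Fin n) ℂ),
    rowSpace A = K → IsCompl K (rowSpace C) →
    ∃ (c : ι → ℕ) (f : (i : ι) → Fin (c i) → MvPolynomial (Fin k × Fin (n - k)) ℂ),
      (∀ i, CutsOutNear (chartTrace A C (Y i)) 0 (f i)) ∧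
      LinearIndependent ℂ (fun q : (i : ι) × Fin (c i) => polyDifferential (f q.1 q.2) 0)

/-- The intersection of the `Y i` in the complex Grassmannian `Gr(k,n)` is transverse: it is so at
each of its points. -/
def IsTransverse {ι : Type*} (k : ℕ) {n : ℕ} (Y : ι → Set (Submodule ℂ (Fin n → ℂ))) : Prop :=
  ∀ K ∈ ⋂ i, Y i, TransverseAt k Y K

end Transversality

/-- The family of subvarieties of the complex Grassmannian `Gr(k,n)` consisting of `Ω_α` (at `none`)
and of `Ω(t₁.L), …, Ω(t_{|α|}.L)`, where `t.L` is the image of `L` under `e_j ↦ t^j e_j`. -/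
def schubertFamily {k n N : ℕ} (L : Submodule ℝ (Fin n → ℝ)) (t : Fin N → ℝ)
    (α : PluckerIndex k n) :
    Option {i : Fin N // (i : ℕ) < α.size} → Set (Submodule ℂ (Fin n → ℂ))
  | none => schubertVariety ℂ α
  | some i => specialSchubert k (complexify (L.map (weightScaling n (t i.1))))

end SchubertCalculus

open SchubertCalculus

/-! The proof degenerates one special Schubert variety at a time. Let `Q` be the matrix of equations
of `L` and `q_γ` its maximal minors. By Cauchy–Binet, the form defining `Ω(t.L)`, restricted to
`Ω_α` and multiplied by a power of `t`, is `∑_{γ ≤ α} q_γ t^(|α|-|γ|) p_γ`. At `t = 0` only `q_α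
p_α` remains, and `q_α ≠ 0` because the complementary Plücker coordinate of `L` is nonzero. The
section of `Ω_α` by `p_α = 0` is the union of the `Ω_β` with `β ⋖ α`, each appearing with
multiplicity one (`InSchubert.exists_covBy`, `InSchubert.of_covBy`).

The parameters are chosen inductively (`exists_parameters`). Suppose `m` of them solve the problem
for all indices of size at most `m`, and let `|α| = m + 1`. As `t → 0`, each nondegenerate solution
on an `Ω_β` with `β ⋖ α` continues to exactly one nearby solution on `Ω_α`, by the inverse function
theorem in the chart normalized in the columns `β` (`local_degeneration`). Compactness of the
Grassmannian leaves no other solutions (`eventually_solutions_near`). Complex conjugation preserves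
the equations and fixes each limit, so uniqueness makes the nearby solution real. Thus the number of
solutions on `Ω_α` is the sum of those on the `Ω_β`, which is the recursion for `d(α)`
(`chainCount_of_not_isBot`).

A second statement travels along the induction: `|γ| + 1` conditions have no common solution on
`Ω_γ` (`eventually_hasNoExcessSolutions`). It keeps solutions on `Ω_α` off the smaller `Ω_β`, hence
inside the open cell `p_α ≠ 0`, and keeps the limits belonging to different `β` apart.

Nondegeneracy means that there are no nonzero tangent vectors over the dual numbers. Since the total
number of equations equals `k(n-k)`, this makes their differentials independent, which is
transversality (`transverseAt_of_isNondegenerate`). -/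

namespace SchubertCalculus

open Filter Topology

/-! ### Bruhat order: size, covers, interlacing and chains. -/

section Combinatorics

variable {k n : ℕ}

noncomputable instance : Fintype (PluckerIndex k n) := Fintype.ofFinite _

/-- Pigeonhole: a permutation cannot inject `Iic s` into `Iio s`. -/
lemma exists_le_perm_ge (σ : Equiv.Perm (Fin k)) (s : Fin k) : ∃ r ≤ s, s ≤ σ r := by
  by_contra! h
  have h1 : (Finset.Iic s).card ≤ (Finset.Iio s).card :=
    Finset.card_le_card_of_injOn σ (fun r hr => by simpa using h r (by simpa using hr))
      σ.injective.injOn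
  simp at h1

/-- Two indices interlace if `β₁ ≤ α₁ < β₂ ≤ α₂ < ⋯`. -/
def Interlaces (β α : PluckerIndex k n) : Prop :=
  (∀ r, β.1 r ≤ α.1 r) ∧ ∀ r s, r < s → α.1 r < β.1 s

lemma Interlaces.refl (α : PluckerIndex k n) : Interlaces α α :=
  ⟨fun _ => le_rfl, fun _ _ h => α.2 h⟩

lemma PluckerIndex.le_apply (α : PluckerIndex k n) (j : Fin k) : (j : ℕ) ≤ α.1 j := by
  obtain ⟨j, hj⟩ := j
  induction j with
  | zero => simp
  | succ j ih =>
    have h1 := ih (by omega)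
    have h2 : α.1 ⟨j, by omega⟩ < α.1 ⟨j + 1, hj⟩ := α.2 (by simp)
    rw [Fin.lt_def] at h2
    simp only at h1 ⊢
    omega

lemma PluckerIndex.apply_add_le (α : PluckerIndex k n) (j : Fin k) :
    (α.1 j : ℕ) + k ≤ n + j := by
  obtain ⟨d, hd⟩ : ∃ d, (j : ℕ) + d + 1 = k := ⟨k - 1 - j, by omega⟩
  induction d generalizing j with
  | zero => have := (α.1 j).2; omega
  | succ d ih =>
    have h1 := ih ⟨j + 1, by omega⟩ (by simp only; omega)
    have h2 : α.1 j < α.1 ⟨j + 1, by omega⟩ := α.2 (by simp [Fin.lt_def])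
    rw [Fin.lt_def] at h2
    simp only at h1
    omega

lemma PluckerIndex.size_add (α : PluckerIndex k n) :
    α.size + ∑ j : Fin k, (j : ℕ) = ∑ j, (α.1 j : ℕ) := by
  rw [PluckerIndex.size, ← Finset.sum_add_distrib]
  exact Finset.sum_congr rfl fun j _ => Nat.sub_add_cancel (α.le_apply j)

lemma PluckerIndex.size_le (α : PluckerIndex k n) : α.size ≤ k * (n - k) := by
  have : α.size ≤ ∑ _j : Fin k, (n - k) :=
    Finset.sum_le_sum fun j _ => by have := α.apply_add_le j; omega
  simpa using this

lemma PluckerIndex.size_lt {α β : PluckerIndex k n} (h : β < α) : β.size < α.size := by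
  have h1 := α.size_add
  have h2 := β.size_add
  have h3 : ∑ j, (β.1 j : ℕ) < ∑ j, (α.1 j : ℕ) := by
    obtain ⟨hle, hne⟩ := lt_iff_le_and_ne.1 h
    obtain ⟨i, hi⟩ : ∃ i, β.1 i ≠ α.1 i := by
      by_contra! hh
      exact hne (Subtype.ext (funext hh))
    exact Finset.sum_lt_sum (fun j _ => hle j)
      ⟨i, Finset.mem_univ _, lt_of_le_of_ne (hle i) (Fin.val_ne_iff.2 hi)⟩
  omega

/-- At the largest position `i` with `β_i < α_i` the two sequences agree further right, so `β_i` can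
be raised by one without losing strict monotonicity. The result lies above `β` and below or at `α`,
hence is `α`. -/
lemma exists_update_of_covBy {α β : PluckerIndex k n} (h : β ⋖ α) :
    ∃ i, α.1 = Function.update β.1 i (α.1 i) ∧ (β.1 i : ℕ) + 1 = α.1 i := by
  obtain ⟨hle, hne⟩ := lt_iff_le_and_ne.1 h.lt
  have hle' : ∀ j, β.1 j ≤ α.1 j := hle
  have hS : (Finset.univ.filter fun i => β.1 i < α.1 i).Nonempty := by
    by_contra! hh
    refine hne (Subtype.ext (funext fun i => le_antisymm (hle i) ?_))
    by_contra! hi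
    have : i ∈ Finset.univ.filter fun i => β.1 i < α.1 i := by simpa using hi
    simp [hh] at this
  obtain ⟨i, hi, hmax⟩ := Finset.exists_max_image _ id hS
  simp only [Finset.mem_filter, Finset.mem_univ, true_and, id] at hi hmax
  have heq : ∀ j, i < j → β.1 j = α.1 j := fun j hj => by
    refine le_antisymm (hle' j) ?_
    by_contra! hh
    exact absurd (hmax j hh) (not_le.2 hj)
  have hb : (β.1 i : ℕ) + 1 < n := by have := (α.1 i).2; rw [Fin.lt_def] at hi; omega
  have hmono : StrictMono (Function.update β.1 i ⟨β.1 i + 1, hb⟩) := by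
    intro a b hab
    rcases eq_or_ne a i with rfl | ha
    · have h1 := α.2 hab
      have h2 := heq b hab
      rw [Function.update_self, Function.update_of_ne hab.ne', h2]
      rw [Fin.lt_def] at *
      simp only
      omega
    · rw [Function.update_of_ne ha]
      have h1 := β.2 hab
      rcases eq_or_ne b i with rfl | hb'
      · rw [Function.update_self]
        rw [Fin.lt_def] at *
        simp only
        omega
      · rwa [Function.update_of_ne hb']
  have hγ : (⟨_, hmono⟩ : PluckerIndex k n) = α := by
    have h1 : (⟨_, hmono⟩ : PluckerIndex k n) ≤ α := by
      intro j
      simp only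
      rcases eq_or_ne j i with rfl | hj
      · rw [Function.update_self, Fin.le_def]
        exact hi
      · rw [Function.update_of_ne hj]
        exact hle' j
    have h2 : β < (⟨_, hmono⟩ : PluckerIndex k n) := by
      refine lt_of_le_of_ne (fun j => ?_) fun hh => ?_
      · simp only
        rcases eq_or_ne j i with rfl | hj
        · rw [Function.update_self, Fin.le_def]
          simp
        · rw [Function.update_of_ne hj]
      · have := congrFun (congrArg Subtype.val hh) i
        simp only [Function.update_self, Fin.ext_iff] at this
        omega
    exact (h1.lt_or_eq).resolve_left fun h3 => h.2 h2 h3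
  have hv : α.1 = Function.update β.1 i ⟨β.1 i + 1, hb⟩ := (congrArg Subtype.val hγ).symm
  have hvi : α.1 i = ⟨β.1 i + 1, hb⟩ := by rw [hv, Function.update_self]
  exact ⟨i, by rw [hvi]; exact hv, by rw [hvi]⟩

lemma size_of_covBy {α β : PluckerIndex k n} (h : β ⋖ α) : β.size + 1 = α.size := by
  obtain ⟨i, h1, h2⟩ := exists_update_of_covBy h
  have h3 := α.size_add
  have h4 := β.size_add
  have h5 : ∑ j, (α.1 j : ℕ) = ∑ j, (β.1 j : ℕ) + 1 := by
    rw [← Finset.add_sum_erase _ _ (Finset.mem_univ i),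
      ← Finset.add_sum_erase _ (fun j => (β.1 j : ℕ)) (Finset.mem_univ i)]
    have : ∑ j ∈ Finset.univ.erase i, (α.1 j : ℕ) = ∑ j ∈ Finset.univ.erase i, (β.1 j : ℕ) :=
      Finset.sum_congr rfl fun j hj => by
        rw [h1, Function.update_of_ne (Finset.ne_of_mem_erase hj)]
    omega
  omega

lemma interlaces_of_covBy {α β : PluckerIndex k n} (h : β ⋖ α) : Interlaces β α := by
  obtain ⟨i, h1, h2⟩ := exists_update_of_covBy h
  have h0 : ∀ j, j ≠ i → α.1 j = β.1 j := fun j hj => by rw [h1, Function.update_of_ne hj]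
  refine ⟨h.le, fun r s hrs => ?_⟩
  rcases eq_or_ne s i with rfl | hs
  · have h3 := β.2 hrs
    rwa [h0 r hrs.ne]
  · rw [← h0 s hs]
    exact α.2 hrs

/-- By interlacing, the columns of `β` that are at most `α_r` are exactly `β_s` for `s ≤ r`, so row
`r` has `α_r - r` free entries. This is the dimension of `Ω_α`, seen in the chart of `β`. -/
lemma card_interlaced {α β : PluckerIndex k n} (h : Interlaces β α) :
    Fintype.card {p : Fin k × Fin n // p.2 ∉ Set.range β.1 ∧ p.2 ≤ α.1 p.1} = α.size := by
  classical
  rw [Fintype.card_subtype, Finset.card_filter, Fintype.sum_prod_type, PluckerIndex.size]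
  refine Finset.sum_congr rfl fun r _ => ?_
  rw [← Finset.card_filter]
  have : (Finset.univ.filter fun j => j ∉ Set.range β.1 ∧ j ≤ α.1 r) =
      Finset.Iic (α.1 r) \ (Finset.Iic r).image β.1 := by
    ext j
    simp only [Finset.mem_filter, Finset.mem_univ, true_and, Finset.mem_sdiff, Finset.mem_Iic,
      Finset.mem_image, Set.mem_range]
    refine ⟨fun ⟨h1, h2⟩ => ⟨h2, fun ⟨s, _, hs⟩ => h1 ⟨s, hs⟩⟩, fun ⟨h1, h2⟩ => ⟨?_, h1⟩⟩
    rintro ⟨s, rfl⟩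
    refine h2 ⟨s, ?_, rfl⟩
    by_contra! hs
    exact absurd h1 (not_le.2 (h.2 r s hs))
  rw [this, Finset.card_sdiff_of_subset, Finset.card_image_of_injective _ β.2.injective]
  · simp
  · intro j hj
    simp only [Finset.mem_image, Finset.mem_Iic] at hj ⊢
    obtain ⟨s, hs, rfl⟩ := hj
    exact (β.2.monotone hs).trans (h.1 r)

/-- The first cardinality is the codimension of `Ω_α`; it counts the equations used for
transversality. -/
lemma card_beyond_add_size (α : PluckerIndex k n) :
    Fintype.card {p : Fin k × Fin n // p.2 ∉ Set.range α.1 ∧ α.1 p.1 < p.2} + α.size =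
      k * (n - k) := by
  classical
  rw [← card_interlaced (Interlaces.refl α), Fintype.card_subtype, Fintype.card_subtype,
    ← Finset.card_union_of_disjoint]
  · have : (Finset.univ.filter fun p : Fin k × Fin n => p.2 ∉ Set.range α.1 ∧ α.1 p.1 < p.2) ∪
        (Finset.univ.filter fun p : Fin k × Fin n => p.2 ∉ Set.range α.1 ∧ p.2 ≤ α.1 p.1) =
        Finset.univ ×ˢ (Finset.univ.image α.1)ᶜ := by
      ext p
      simp only [Finset.mem_union, Finset.mem_filter, Finset.mem_univ, true_and,
        Finset.mem_product, Finset.mem_compl, Finset.mem_image, Set.mem_range]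
      have := lt_or_ge (α.1 p.1) p.2
      tauto
    rw [this, Finset.card_product, Finset.card_compl,
      Finset.card_image_of_injective _ α.2.injective]
    simp
  · rw [Finset.disjoint_filter]
    intro p _ h1 h2
    exact absurd h1.2 (not_lt.2 h2.2)

/-! ### The recursion for the number of saturated chains. -/

section Chains

/-- The saturated chains from the minimal element to `α`. -/
def saturatedChains (α : PluckerIndex k n) : Set (List (PluckerIndex k n)) :=
  {c | c.IsChain (· ⋖ ·) ∧ (∃ γ, IsBot γ ∧ c.head? = some γ) ∧ c.getLast? = some α}

lemma saturatedChains_of_isBot {α : PluckerIndex k n} (hα : IsBot α) :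
    saturatedChains α = {[α]} := by
  ext c
  constructor
  · rintro ⟨h1, -, h3⟩
    rcases List.eq_nil_or_concat c with rfl | ⟨c, a, rfl⟩
    · simp at h3
    · obtain rfl : a = α := by simpa using h3
      rcases List.eq_nil_or_concat c with rfl | ⟨c, b, rfl⟩
      · simp
      · have : b ⋖ a := by
          simp only [List.concat_eq_append, List.append_assoc, List.singleton_append] at h1
          exact (List.isChain_append_cons_cons.1 h1).2.1
        exact absurd (hα b) (not_le_of_gt this.lt)
  · rintro rfl
    exact ⟨by simp, ⟨α, hα, by simp⟩, by simp⟩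

lemma saturatedChains_of_not_isBot {α : PluckerIndex k n} (hα : ¬ IsBot α) :
    saturatedChains α =
      ⋃ β : {β : PluckerIndex k n // β ⋖ α}, (fun c => c ++ [α]) '' saturatedChains β.1 := by
  ext c
  simp only [Set.mem_iUnion, Set.mem_image]
  constructor
  · rintro ⟨h1, ⟨γ, hγ, h2⟩, h3⟩
    rcases List.eq_nil_or_concat c with rfl | ⟨c, a, rfl⟩
    · simp at h3
    · obtain rfl : a = α := by simpa using h3
      rcases List.eq_nil_or_concat c with rfl | ⟨c, b, rfl⟩
      · simp only [List.concat_eq_append, List.nil_append, List.head?_cons,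
          Option.some.injEq] at h2
        exact absurd (h2 ▸ hγ) hα
      · simp only [List.concat_eq_append, List.append_assoc, List.singleton_append] at h1 h2 ⊢
        have h4 := List.isChain_append_cons_cons.1 h1
        refine ⟨⟨b, h4.2.1⟩, c ++ [b], ⟨h4.1, ⟨γ, hγ, ?_⟩, by simp⟩, by simp⟩
        cases c <;> simpa using h2
  · rintro ⟨⟨β, hβ⟩, c, ⟨h1, ⟨γ, hγ, h2⟩, h3⟩, rfl⟩
    rcases List.eq_nil_or_concat c with rfl | ⟨c, a, rfl⟩
    · simp at h3
    · obtain rfl : a = β := by simpa using h3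
      refine ⟨?_, ⟨γ, hγ, ?_⟩, by simp⟩
      · simp only [List.concat_eq_append, List.append_assoc, List.singleton_append] at h1 ⊢
        exact List.isChain_append_cons_cons.2 ⟨h1, hβ, by simp⟩
      · cases c <;> simpa using h2

lemma saturatedChains_finite (α : PluckerIndex k n) : (saturatedChains α).Finite := by
  induction α using WellFoundedLT.induction with
  | _ α ih =>
    by_cases hα : IsBot α
    · rw [saturatedChains_of_isBot hα]
      exact Set.finite_singleton _
    · rw [saturatedChains_of_not_isBot hα]
      exact Set.finite_iUnion fun β => (ih β.1 β.2.lt).image _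

lemma chainCount_of_isBot {α : PluckerIndex k n} (hα : IsBot α) : chainCount α = 1 := by
  change (saturatedChains α).ncard = 1
  rw [saturatedChains_of_isBot hα, Set.ncard_singleton]

/-- Removing the top of a chain leaves a chain ending at some `β ⋖ α`. The solutions of the Schubert
problem obey the same recursion. -/
lemma chainCount_of_not_isBot {α : PluckerIndex k n} (hα : ¬ IsBot α) :
    chainCount α = ∑ᶠ β : {β : PluckerIndex k n // β ⋖ α}, chainCount β.1 := by
  change (saturatedChains α).ncard = _
  have hinj : Function.Injective (fun c : List (PluckerIndex k n) => c ++ [α]) :=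
    List.append_left_injective _
  rw [saturatedChains_of_not_isBot hα, Set.ncard_iUnion_of_finite]
  · refine finsum_congr fun β => ?_
    rw [Set.ncard_image_of_injective _ hinj]
    rfl
  · exact fun β => (saturatedChains_finite β.1).image _
  · intro β β' hne
    rw [Function.onFun, Set.disjoint_left]
    rintro _ ⟨c, hc, rfl⟩ ⟨c', hc', h⟩
    obtain rfl := hinj h
    exact hne (Subtype.ext (Option.some_injective _ (hc.2.2.symm.trans hc'.2.2)))

end Chains

lemma isBot_of_size_eq_zero {α : PluckerIndex k n} (h : α.size = 0) : IsBot α := by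
  intro γ j
  have h1 := (Finset.sum_eq_zero_iff.1 h) j (Finset.mem_univ j)
  have h2 := γ.le_apply j
  rw [Fin.le_def]
  omega

lemma not_isBot_of_size_pos {α : PluckerIndex k n} (hkn : k ≤ n) (h : 0 < α.size) :
    ¬ IsBot α := by
  intro hα
  have h0 := α.size_add
  have h1 : ∑ j, (α.1 j : ℕ) ≤ ∑ j : Fin k, (j : ℕ) :=
    Finset.sum_le_sum fun j _ => hα ⟨Fin.castLE hkn, Fin.strictMono_castLE hkn⟩ j
  omega

end Combinatorics

/-! ### Maximal minors and the equations of Schubert varieties over a commutative ring. -/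

section Minors

variable {k n : ℕ} {R S : Type*} [CommRing R] [CommRing S]

/-- The determinant of the columns `f` of `B`. -/
def colMinor (B : Matrix (Fin k) (Fin n) R) (f : Fin k → Fin n) : R :=
  (B.submatrix id f).det

lemma colMinor_mul (P : Matrix (Fin k) (Fin k) R) (B : Matrix (Fin k) (Fin n) R)
    (f : Fin k → Fin n) : colMinor (P * B) f = P.det * colMinor B f := by
  rw [colMinor, colMinor, ← Matrix.det_mul]
  rfl

lemma colMinor_map (φ : R →+* S) (B : Matrix (Fin k) (Fin n) R) (f : Fin k → Fin n) :
    colMinor (B.map φ) f = φ (colMinor B f) := by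
  rw [colMinor, colMinor, RingHom.map_det]
  rfl

lemma colMinor_comp_perm (B : Matrix (Fin k) (Fin n) R) (f : Fin k → Fin n)
    (σ : Equiv.Perm (Fin k)) :
    colMinor B (f ∘ σ) = ((Equiv.Perm.sign σ : ℤ) : R) * colMinor B f :=
  Matrix.det_permute' σ (B.submatrix id f)

lemma colMinor_of_not_injective (B : Matrix (Fin k) (Fin n) R) {f : Fin k → Fin n}
    (hf : ¬ Function.Injective f) : colMinor B f = 0 := by
  simp only [Function.Injective, not_forall] at hf
  obtain ⟨i, j, hij, hne⟩ := hf
  exact Matrix.det_zero_of_column_eq hne fun r => by simp [hij]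

lemma exists_sorted {f : Fin k → Fin n} (hf : Function.Injective f) :
    ∃ (γ : PluckerIndex k n) (σ : Equiv.Perm (Fin k)), f = γ.1 ∘ σ := by
  refine ⟨⟨f ∘ Tuple.sort f, (Tuple.monotone_sort f).strictMono_of_injective
    (hf.comp (Tuple.sort f).injective)⟩, (Tuple.sort f)⁻¹, ?_⟩
  ext i
  simp

/-- Cramer's rule for the identity matrix: in a normalized chart the entries are themselves minors.
-/
lemma colMinor_update {B : Matrix (Fin k) (Fin n) R} {f : Fin k → Fin n}
    (hB : B.submatrix id f = 1) (r : Fin k) (j : Fin n) :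
    colMinor B (Function.update f r j) = B r j := by
  have : B.submatrix id (Function.update f r j) =
      (1 : Matrix (Fin k) (Fin k) R).updateCol r (fun i => B i j) := by
    ext a b
    rcases eq_or_ne b r with rfl | hb
    · simp
    · rw [Matrix.updateCol_ne hb, ← hB]
      simp [hb]
  rw [colMinor, this, ← Matrix.cramer_apply, Matrix.cramer_one]
  rfl

/-- The Cauchy–Binet formula. -/
theorem det_mul_eq_sum_colMinor (B : Matrix (Fin k) (Fin n) R) (Q : Matrix (Fin n) (Fin k) R) :
    (B * Q).det = ∑ γ : PluckerIndex k n, colMinor B γ.1 * (Q.submatrix γ.1 id).det := by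
  classical
  have h1 : (B * Q).det = ∑ f : Fin k → Fin n, colMinor B f * ∏ i, Q (f i) i := by
    simp only [Matrix.det_apply', Matrix.mul_apply, Finset.prod_univ_sum, Finset.mul_sum,
      Fintype.piFinset_univ, colMinor, Finset.sum_mul]
    rw [Finset.sum_comm]
    refine Finset.sum_congr rfl fun f _ => Finset.sum_congr rfl fun σ _ => ?_
    simp [Finset.prod_mul_distrib, mul_assoc]
  have h2 : ∑ γ : PluckerIndex k n, colMinor B γ.1 * (Q.submatrix γ.1 id).det =
      ∑ p : PluckerIndex k n × Equiv.Perm (Fin k),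
        colMinor B (p.1.1 ∘ p.2) * ∏ i, Q ((p.1.1 ∘ p.2) i) i := by
    rw [Fintype.sum_prod_type]
    refine Finset.sum_congr rfl fun γ _ => ?_
    rw [Matrix.det_apply', Finset.mul_sum]
    refine Finset.sum_congr rfl fun σ _ => ?_
    rw [colMinor_comp_perm]
    simp only [Matrix.submatrix_apply, id, Function.comp]
    ring
  rw [h1, h2]
  symm
  -- The injective maps are exactly the pairs of an increasing sequence and a permutation; the
  -- others have two equal columns.
  refine Finset.sum_of_injOn (fun p => p.1.1 ∘ p.2) ?_ ?_ ?_ ?_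
  · rintro ⟨γ, σ⟩ - ⟨γ', σ'⟩ - h
    simp only at h
    have h3 : Set.range γ.1 = Set.range γ'.1 := by
      rw [← σ.surjective.range_comp γ.1, ← σ'.surjective.range_comp γ'.1, h]
    have h4 : γ = γ' := Subtype.ext ((γ.2.range_inj γ'.2).1 h3)
    subst h4
    have h5 : σ = σ' := Equiv.ext fun i => γ.2.injective (congrFun h i)
    rw [h5]
  · exact fun _ _ => Finset.mem_coe.2 (Finset.mem_univ _)
  · intro f _ hf
    by_cases hinj : Function.Injective f
    · obtain ⟨γ, σ, rfl⟩ := exists_sorted hinj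
      exact absurd ⟨(γ, σ), by simp, rfl⟩ hf
    · rw [colMinor_of_not_injective B hinj, zero_mul]
  · exact fun _ _ => rfl

/-- The matrix `B` represents a point of the Schubert variety `Ω_α` over the ring `R`. -/
def InSchubert (α : PluckerIndex k n) (B : Matrix (Fin k) (Fin n) R) : Prop :=
  ∀ γ : PluckerIndex k n, ¬ γ ≤ α → colMinor B γ.1 = 0

lemma InSchubert.mul_left {α : PluckerIndex k n} {B : Matrix (Fin k) (Fin n) R}
    (h : InSchubert α B) (P : Matrix (Fin k) (Fin k) R) : InSchubert α (P * B) := fun γ hγ => by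
  rw [colMinor_mul, h γ hγ, mul_zero]

lemma InSchubert.map {α : PluckerIndex k n} {B : Matrix (Fin k) (Fin n) R}
    (h : InSchubert α B) (φ : R →+* S) : InSchubert α (B.map φ) := fun γ hγ => by
  rw [colMinor_map, h γ hγ, map_zero]

lemma InSchubert.mono {α α' : PluckerIndex k n} {B : Matrix (Fin k) (Fin n) R}
    (h : InSchubert α B) (hle : α ≤ α') : InSchubert α' B :=
  fun γ hγ => h γ fun h' => hγ (h'.trans hle)

/-- If `α_s < γ_s`, every permutation sends some `r ≤ s` to a position at least `s`. That factor of
its Leibniz term lies beyond the staircase and vanishes. -/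
lemma inSchubert_of_entries {α : PluckerIndex k n} {B : Matrix (Fin k) (Fin n) R}
    (h : ∀ r j, α.1 r < j → B r j = 0) : InSchubert α B := by
  intro γ hγ
  obtain ⟨s, hs⟩ : ∃ s, α.1 s < γ.1 s := by
    by_contra! hh
    exact hγ fun r => hh r
  rw [colMinor, ← Matrix.det_transpose, Matrix.det_apply]
  refine Finset.sum_eq_zero fun σ _ => ?_
  obtain ⟨r, hr, hrs⟩ := exists_le_perm_ge σ s
  have h0 : B r (γ.1 (σ r)) = 0 :=
    h _ _ (((α.2.monotone hr).trans_lt hs).trans_le (γ.2.monotone hrs))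
  rw [Finset.prod_eq_zero (Finset.mem_univ r) (by simpa using h0), smul_zero]

/-- Up to sign, the entry is the minor obtained from `β` by replacing `β_r` with `j`; interlacing
prevents the sorted index from being at most `α`. -/
lemma InSchubert.entries {α β : PluckerIndex k n} {B : Matrix (Fin k) (Fin n) R}
    (h : InSchubert α B) (hβ : Interlaces β α) (hB : B.submatrix id β.1 = 1)
    (r : Fin k) (j : Fin n) (hj : α.1 r < j) : B r j = 0 := by
  by_cases hjβ : j ∈ Set.range β.1
  · obtain ⟨s, rfl⟩ := hjβ
    have hne : r ≠ s := by
      rintro rfl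
      exact absurd (hβ.1 r) (not_le.2 hj)
    have := congrFun (congrFun hB r) s
    simpa [Matrix.one_apply_ne hne] using this
  · have hinj : Function.Injective (Function.update β.1 r j) := by
      intro a b hab
      rcases eq_or_ne a r with ha | ha <;> rcases eq_or_ne b r with hb | hb
      · rw [ha, hb]
      · rw [ha, Function.update_self, Function.update_of_ne hb] at hab
        exact absurd ⟨b, hab.symm⟩ hjβ
      · rw [hb, Function.update_self, Function.update_of_ne ha] at hab
        exact absurd ⟨a, hab⟩ hjβ
      · rw [Function.update_of_ne ha, Function.update_of_ne hb] at hab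
        exact β.2.injective hab
    obtain ⟨γ, σ, hσ⟩ := exists_sorted hinj
    have hγ : ¬ γ ≤ α := by
      intro hle
      -- The `s`-th smallest column, with `s ≤ r`, is then either `j` or some `β_t` with `t > r`;
      -- both exceed `α_r ≥ α_s`.
      obtain ⟨s, hs, hrs⟩ := exists_le_perm_ge σ⁻¹ r
      have h1 : γ.1 s ≤ α.1 r := (hle s).trans (α.2.monotone hs)
      have h2 : γ.1 s = Function.update β.1 r j (σ⁻¹ s) := by
        rw [hσ]
        simp
      rcases hrs.eq_or_lt with heq | hlt
      · rw [h2, ← heq, Function.update_self] at h1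
        exact absurd h1 (not_le.2 hj)
      · rw [h2, Function.update_of_ne hlt.ne'] at h1
        exact absurd h1 (not_le.2 (hβ.2 _ _ hlt))
    rw [← colMinor_update hB, hσ, colMinor_comp_perm, h γ hγ, mul_zero]

lemma colMinor_of_update_eq {α β : PluckerIndex k n} {B : Matrix (Fin k) (Fin n) R}
    (hB : B.submatrix id β.1 = 1) {i : Fin k} (hi : α.1 = Function.update β.1 i (α.1 i)) :
    colMinor B α.1 = B i (α.1 i) := by
  rw [hi, colMinor_update hB, ← hi]

/-- In the chart of `β` the staircases of `α` and `β` differ in one entry, and that entry is `p_α`.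
As this holds over any ring, in particular the dual numbers, `p_α` cuts out `Ω_β` with multiplicity
one. -/
lemma InSchubert.of_covBy {α β : PluckerIndex k n} {B : Matrix (Fin k) (Fin n) R}
    (h : InSchubert α B) (hβ : β ⋖ α) (hB : B.submatrix id β.1 = 1) (h0 : colMinor B α.1 = 0) :
    InSchubert β B := by
  obtain ⟨i, hi, hi'⟩ := exists_update_of_covBy hβ
  refine inSchubert_of_entries fun r j hj => ?_
  rcases lt_or_ge (α.1 r) j with hj' | hj'
  · exact h.entries (interlaces_of_covBy hβ) hB r j hj'
  · rcases eq_or_ne r i with rfl | hr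
    · obtain rfl : j = α.1 r := by
        rw [Fin.le_def] at hj'
        rw [Fin.lt_def] at hj
        rw [Fin.ext_iff]
        omega
      rw [← colMinor_of_update_eq hB hi, h0]
    · rw [hi, Function.update_of_ne hr] at hj'
      exact absurd hj (not_lt.2 hj')

end Minors

/-! ### Normalized matrices and Schubert cells over a field. -/

section Field

variable {k n : ℕ} {F : Type*} [Field F]

/-- The matrix representing the row space of `B` with the identity matrix in the columns `γ`. -/
noncomputable def normalize (γ : PluckerIndex k n) (B : Matrix (Fin k) (Fin n) F) :
    Matrix (Fin k) (Fin n) F :=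
  (B.submatrix id γ.1)⁻¹ * B

lemma normalize_submatrix {γ : PluckerIndex k n} {B : Matrix (Fin k) (Fin n) F}
    (h : colMinor B γ.1 ≠ 0) : (normalize γ B).submatrix id γ.1 = 1 :=
  Matrix.nonsing_inv_mul (B.submatrix id γ.1) (isUnit_iff_ne_zero.2 h)

lemma eq_mul_normalize {γ : PluckerIndex k n} {B : Matrix (Fin k) (Fin n) F}
    (h : colMinor B γ.1 ≠ 0) : B = B.submatrix id γ.1 * normalize γ B := by
  rw [normalize, ← Matrix.mul_assoc, Matrix.mul_nonsing_inv _ (isUnit_iff_ne_zero.2 h),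
    Matrix.one_mul]

lemma normalize_eq_self {γ : PluckerIndex k n} {B : Matrix (Fin k) (Fin n) F}
    (h : B.submatrix id γ.1 = 1) : normalize γ B = B := by
  rw [normalize, h, inv_one, Matrix.one_mul]

lemma colMinor_eq_one {γ : PluckerIndex k n} {R : Type*} [CommRing R]
    {B : Matrix (Fin k) (Fin n) R}
    (h : B.submatrix id γ.1 = 1) : colMinor B γ.1 = 1 := by
  rw [colMinor, h, Matrix.det_one]

lemma normalize_mul {γ : PluckerIndex k n} (P : Matrix (Fin k) (Fin k) F)
    (hP : P.det ≠ 0) (B : Matrix (Fin k) (Fin n) F) :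
    normalize γ (P * B) = normalize γ B := by
  have : (P * B).submatrix id γ.1 = P * B.submatrix id γ.1 := rfl
  rw [normalize, this, Matrix.mul_inv_rev, Matrix.mul_assoc, ← Matrix.mul_assoc P⁻¹,
    Matrix.nonsing_inv_mul _ (isUnit_iff_ne_zero.2 hP), Matrix.one_mul, normalize]

/-- The Schubert cells cover the Grassmannian. -/
lemma exists_inSchubert {B : Matrix (Fin k) (Fin n) F}
    (hB : ∃ γ : PluckerIndex k n, colMinor B γ.1 ≠ 0) :
    ∃ δ : PluckerIndex k n, colMinor B δ.1 ≠ 0 ∧ InSchubert δ B := by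
  classical
  obtain ⟨γ₀, hγ₀⟩ := hB
  -- Take a nonzero minor with the largest index sum. A nonzero entry beyond the staircase of `δ`
  -- would give a nonzero minor with a larger sum.
  obtain ⟨δ, hδ, hmax⟩ := Finset.exists_max_image
    (Finset.univ.filter fun γ : PluckerIndex k n => colMinor B γ.1 ≠ 0)
    (fun γ => ∑ i, (γ.1 i : ℕ)) ⟨γ₀, by simpa using hγ₀⟩
  simp only [Finset.mem_filter, Finset.mem_univ, true_and] at hδ hmax
  refine ⟨δ, hδ, ?_⟩
  rw [eq_mul_normalize hδ]
  refine InSchubert.mul_left (inSchubert_of_entries fun r j hj => ?_) _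
  have hN := normalize_submatrix hδ
  rw [← colMinor_update hN]
  by_cases hinj : Function.Injective (Function.update δ.1 r j)
  · obtain ⟨γ, σ, hσ⟩ := exists_sorted hinj
    by_contra hne
    rw [hσ, colMinor_comp_perm, normalize, colMinor_mul] at hne
    have h1 := hmax γ fun h => hne (by rw [h, mul_zero, mul_zero])
    have h2 : ∑ i, (Function.update δ.1 r j i : ℕ) = ∑ i, (γ.1 i : ℕ) := by
      rw [hσ]
      exact Equiv.sum_comp σ fun i => (γ.1 i : ℕ)
    have h3 : ∑ i, (δ.1 i : ℕ) < ∑ i, (Function.update δ.1 r j i : ℕ) := by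
      refine Finset.sum_lt_sum (fun i _ => ?_) ⟨r, Finset.mem_univ _, ?_⟩
      · rcases eq_or_ne i r with rfl | hi
        · rw [Function.update_self]
          exact hj.le
        · rw [Function.update_of_ne hi]
      · rw [Function.update_self]
        exact hj
    omega
  · exact colMinor_of_not_injective _ hinj

lemma InSchubert.exists_covBy {α : PluckerIndex k n} {B : Matrix (Fin k) (Fin n) F}
    (h : InSchubert α B) (hB : ∃ γ : PluckerIndex k n, colMinor B γ.1 ≠ 0)
    (h0 : colMinor B α.1 = 0) : ∃ β, β ⋖ α ∧ InSchubert β B := by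
  obtain ⟨δ, hδ, hS⟩ := exists_inSchubert hB
  have hle : δ ≤ α := by
    by_contra hle
    exact hδ (h δ hle)
  have hlt : δ < α := hle.lt_of_ne (by rintro rfl; exact hδ h0)
  obtain ⟨β, hδβ, hβ⟩ := exists_le_covBy_of_lt hlt
  exact ⟨β, hβ, hS.mono hδβ⟩

end Field

/-! ### Incidence forms, their degeneration, and polynomial systems in charts. -/

section Forms

variable {k n : ℕ} {R S : Type*} [CommRing R] [CommRing S] [Algebra ℂ R] [Algebra ℂ S]

/-- The form on `k × n` matrices whose zeroes are the row spaces that meet the left kernel of `W`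
nontrivially. -/
def incidenceForm (W : Matrix (Fin n) (Fin k) ℂ) (B : Matrix (Fin k) (Fin n) R) : R :=
  (B * W.map (algebraMap ℂ R)).det

lemma incidenceForm_mul (W : Matrix (Fin n) (Fin k) ℂ) (P : Matrix (Fin k) (Fin k) R)
    (B : Matrix (Fin k) (Fin n) R) :
    incidenceForm W (P * B) = P.det * incidenceForm W B := by
  rw [incidenceForm, Matrix.mul_assoc, Matrix.det_mul, incidenceForm]

lemma incidenceForm_map (φ : R →ₐ[ℂ] S) (W : Matrix (Fin n) (Fin k) ℂ)
    (B : Matrix (Fin k) (Fin n) R) :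
    incidenceForm W (B.map φ) = φ (incidenceForm W B) := by
  rw [incidenceForm, incidenceForm, AlgHom.map_det]
  congr 1
  ext i j
  simp [Matrix.mul_apply]

/-- The equations of the image of the left kernel of `Q` under `e_j ↦ t ^ j e_j`. -/
noncomputable def scaledEquations (Q : Matrix (Fin n) (Fin k) ℝ) (t : ℂ) :
    Matrix (Fin n) (Fin k) ℂ :=
  Matrix.of fun j r => t⁻¹ ^ ((j : ℕ) + 1) * (Q j r : ℂ)

/-- The complexified maximal minors of `Q`. -/
noncomputable def rowMinor (Q : Matrix (Fin n) (Fin k) ℝ) (γ : PluckerIndex k n) : ℂ :=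
  ((Q.submatrix γ.1 id).det : ℝ)

lemma det_scaledEquations_submatrix (Q : Matrix (Fin n) (Fin k) ℝ) (t : ℂ)
    (γ : PluckerIndex k n) :
    ((scaledEquations Q t).submatrix γ.1 id).det =
      t⁻¹ ^ (γ.size + ∑ i : Fin k, ((i : ℕ) + 1)) * rowMinor Q γ := by
  have h1 : (scaledEquations Q t).submatrix γ.1 id =
      Matrix.of fun i j => t⁻¹ ^ ((γ.1 i : ℕ) + 1) *
        (Q.submatrix γ.1 id).map Complex.ofRealHom i j := rfl
  have h2 : γ.size + ∑ i : Fin k, ((i : ℕ) + 1) = ∑ i, ((γ.1 i : ℕ) + 1) := by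
    rw [Finset.sum_add_distrib, Finset.sum_add_distrib, ← γ.size_add, add_assoc]
  rw [h1, Matrix.det_mul_column, h2, Finset.prod_pow_eq_pow_sum, rowMinor,
    ← Complex.ofRealHom_eq_coe, RingHom.map_det]
  rfl

/-- The restriction to `Ω_α` of the form defining the image of the left kernel of `Q` under
`e_j ↦ τ ^ j e_j`, rescaled so that it is polynomial in `τ`. -/
noncomputable def degenerationForm (Q : Matrix (Fin n) (Fin k) ℝ) (α : PluckerIndex k n) (τ : R)
    (B : Matrix (Fin k) (Fin n) R) : R :=
  open scoped Classical in
  ∑ γ : PluckerIndex k n, if γ ≤ α then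
    algebraMap ℂ R (rowMinor Q γ) * τ ^ (α.size - γ.size) * colMinor B γ.1 else 0

/-- Every `γ < α` has strictly smaller size, so its term carries a positive power of `τ`. -/
lemma degenerationForm_zero (Q : Matrix (Fin n) (Fin k) ℝ) (α : PluckerIndex k n)
    (B : Matrix (Fin k) (Fin n) R) :
    degenerationForm Q α 0 B = algebraMap ℂ R (rowMinor Q α) * colMinor B α.1 := by
  rw [degenerationForm, Finset.sum_eq_single α]
  · simp
  · intro γ _ hγ
    split_ifs with h
    · have := PluckerIndex.size_lt (h.lt_of_ne hγ)
      rw [zero_pow (by omega), mul_zero, zero_mul]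
    · rfl
  · simp

lemma degenerationForm_map (φ : R →ₐ[ℂ] S) (Q : Matrix (Fin n) (Fin k) ℝ) (α : PluckerIndex k n)
    (τ : R) (B : Matrix (Fin k) (Fin n) R) :
    degenerationForm Q α (φ τ) (B.map φ) = φ (degenerationForm Q α τ B) := by
  rw [degenerationForm, degenerationForm, map_sum]
  refine Finset.sum_congr rfl fun γ _ => ?_
  split_ifs with h
  · rw [map_mul, map_mul, map_pow, AlgHom.commutes]
    congr 1
    exact colMinor_map (φ : R →+* S) B γ.1
  · rw [map_zero]

/-- This is Cauchy–Binet: the minor of the scaled equations on `γ` carries `τ` to the power `-(|γ| +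
const)`, and the terms with `γ ≰ α` vanish on `Ω_α`. -/
lemma degenerationForm_eq (Q : Matrix (Fin n) (Fin k) ℝ) {α : PluckerIndex k n} {τ : ℂ}
    (hτ : τ ≠ 0) {B : Matrix (Fin k) (Fin n) R} (hB : InSchubert α B) :
    degenerationForm Q α (algebraMap ℂ R τ) B =
      algebraMap ℂ R (τ ^ (α.size + ∑ i : Fin k, ((i : ℕ) + 1))) *
        incidenceForm (scaledEquations Q τ) B := by
  rw [degenerationForm, incidenceForm, det_mul_eq_sum_colMinor, Finset.mul_sum]
  refine Finset.sum_congr rfl fun γ _ => ?_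
  split_ifs with h
  · have h1 : (((scaledEquations Q τ).map (algebraMap ℂ R)).submatrix γ.1 id).det =
        algebraMap ℂ R ((scaledEquations Q τ).submatrix γ.1 id).det := by
      rw [RingHom.map_det]
      rfl
    have hle : γ.size ≤ α.size := by
      rcases h.eq_or_lt with rfl | h'
      · exact le_rfl
      · exact (PluckerIndex.size_lt h').le
    have h2 : τ ^ (α.size + ∑ i : Fin k, ((i : ℕ) + 1)) *
        τ⁻¹ ^ (γ.size + ∑ i : Fin k, ((i : ℕ) + 1)) = τ ^ (α.size - γ.size) := by
      have : α.size + ∑ i : Fin k, ((i : ℕ) + 1) =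
          (α.size - γ.size) + (γ.size + ∑ i : Fin k, ((i : ℕ) + 1)) := by omega
      rw [this, pow_add, mul_assoc, ← mul_pow, mul_inv_cancel₀ hτ, one_pow, mul_one]
    rw [h1, det_scaledEquations_submatrix, ← map_pow, ← h2, map_mul, map_mul]
    ring
  · rw [hB γ h, zero_mul, mul_zero]

lemma degenerationForm_eq_zero_iff (Q : Matrix (Fin n) (Fin k) ℝ) {α : PluckerIndex k n} {τ : ℂ}
    (hτ : τ ≠ 0) {B : Matrix (Fin k) (Fin n) R} (hB : InSchubert α B) :
    degenerationForm Q α (algebraMap ℂ R τ) B = 0 ↔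
      incidenceForm (scaledEquations Q τ) B = 0 := by
  rw [degenerationForm_eq Q hτ hB]
  exact IsUnit.mul_right_eq_zero ((IsUnit.mk0 _ (pow_ne_zero _ hτ)).map (algebraMap ℂ R))

/-- The matrix `B` is normalized in the columns `β`, and represents a point of `Ω_α` which is a
common zero of the first `m` incidence forms and of the degenerate form at `τ`. -/
structure IsChartSolution (Q : Matrix (Fin n) (Fin k) ℝ) (W : ℕ → Matrix (Fin n) (Fin k) ℂ)
    (α β : PluckerIndex k n) (m : ℕ) (τ : R) (B : Matrix (Fin k) (Fin n) R) : Prop where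
  normalized : B.submatrix id β.1 = 1
  inSchubert : InSchubert α B
  incidence : ∀ s < m, incidenceForm (W s) B = 0
  degeneration : degenerationForm Q α τ B = 0

/-- The point of the affine space with coordinates `τ` and the entries of `B`. -/
def matrixPoint (B : Matrix (Fin k) (Fin n) R) (τ : R) : Option (Fin k × Fin n) → R
  | none => τ
  | some p => B p.1 p.2

/-- The generic `k × n` matrix. -/
noncomputable def genericMatrix (k n : ℕ) :
    Matrix (Fin k) (Fin n) (MvPolynomial (Option (Fin k × Fin n)) ℂ) :=
  Matrix.of fun r j => MvPolynomial.X (some (r, j))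

lemma genericMatrix_map (B : Matrix (Fin k) (Fin n) R) (τ : R) :
    (genericMatrix k n).map (MvPolynomial.aeval (R := ℂ) (matrixPoint B τ)) = B := by
  ext r j
  simp [genericMatrix, matrixPoint]

open scoped Classical in
/-- The system of polynomial equations for `IsChartSolution`, squared up by the parameter `τ`. -/
noncomputable def chartSystem (Q : Matrix (Fin n) (Fin k) ℝ) (W : ℕ → Matrix (Fin n) (Fin k) ℂ)
    (α β : PluckerIndex k n) (m : ℕ)
    (e : {p : Fin k × Fin n // p.2 ∉ Set.range β.1 ∧ p.2 ≤ α.1 p.1} ≃ Fin (m + 1)) :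
    Option (Fin k × Fin n) → MvPolynomial (Option (Fin k × Fin n)) ℂ
  | none => MvPolynomial.X none
  | some p =>
    if h : p.2 ∉ Set.range β.1 ∧ p.2 ≤ α.1 p.1 then
      if (e ⟨p, h⟩ : ℕ) < m then incidenceForm (W (e ⟨p, h⟩)) (genericMatrix k n)
      else degenerationForm Q α (MvPolynomial.X none) (genericMatrix k n)
    else MvPolynomial.X (some p) - if p.2 = β.1 p.1 then 1 else 0

/-- Interlacing turns normalization and membership in `Ω_α` into prescribed values of all but the `m
+ 1` free entries. To these, `e` assigns the `m` incidence forms and, in the last slot, the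
degenerate form. Allowing any algebra `R` covers both points and tangent vectors. -/
lemma isChartSolution_iff (Q : Matrix (Fin n) (Fin k) ℝ) (W : ℕ → Matrix (Fin n) (Fin k) ℂ)
    {α β : PluckerIndex k n} (hβ : Interlaces β α) (m : ℕ)
    (e : {p : Fin k × Fin n // p.2 ∉ Set.range β.1 ∧ p.2 ≤ α.1 p.1} ≃ Fin (m + 1))
    (τ : R) (B : Matrix (Fin k) (Fin n) R) :
    IsChartSolution Q W α β m τ B ↔
      ∀ p, MvPolynomial.aeval (matrixPoint B τ) (chartSystem Q W α β m e (some p)) = 0 := by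
  classical
  have key1 : ∀ p (h : p.2 ∉ Set.range β.1 ∧ p.2 ≤ α.1 p.1),
      MvPolynomial.aeval (matrixPoint B τ) (chartSystem Q W α β m e (some p)) =
      if (e ⟨p, h⟩ : ℕ) < m then incidenceForm (W (e ⟨p, h⟩)) B
      else degenerationForm Q α τ B := by
    intro p h
    simp only [chartSystem]
    rw [dif_pos h]
    split_ifs with h'
    · rw [← incidenceForm_map, genericMatrix_map]
    · rw [← degenerationForm_map, genericMatrix_map, MvPolynomial.aeval_X]
      rfl
  have key2 : ∀ p, ¬ (p.2 ∉ Set.range β.1 ∧ p.2 ≤ α.1 p.1) →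
      MvPolynomial.aeval (matrixPoint B τ) (chartSystem Q W α β m e (some p)) =
      B p.1 p.2 - if p.2 = β.1 p.1 then 1 else 0 := by
    intro p h
    simp only [chartSystem]
    rw [dif_neg h, map_sub, MvPolynomial.aeval_X]
    split_ifs <;> simp [matrixPoint]
  constructor
  · rintro ⟨h1, h2, h3, h4⟩ p
    by_cases h : p.2 ∉ Set.range β.1 ∧ p.2 ≤ α.1 p.1
    · rw [key1 p h]
      split_ifs with h'
      · exact h3 _ h'
      · exact h4
    · rw [key2 p h, sub_eq_zero]
      by_cases h' : p.2 ∈ Set.range β.1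
      · obtain ⟨s, hs⟩ := h'
        have := congrFun (congrFun h1 p.1) s
        simp only [Matrix.submatrix_apply, id, hs] at this
        rw [this, ← hs, Matrix.one_apply]
        simp only [β.2.injective.eq_iff, eq_comm]
      · have h5 : α.1 p.1 < p.2 := by
          by_contra hh
          exact h ⟨h', not_lt.1 hh⟩
        rw [h2.entries hβ h1 _ _ h5, if_neg]
        exact fun hh => h' ⟨_, hh.symm⟩
  · intro h
    refine ⟨?_, inSchubert_of_entries fun r j hj => ?_, fun s hs => ?_, ?_⟩
    · ext r s
      have := h (r, β.1 s)
      rw [key2 _ (fun hh => hh.1 ⟨s, rfl⟩), sub_eq_zero] at this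
      simp only [Matrix.submatrix_apply, id, Matrix.one_apply, this]
      simp only [β.2.injective.eq_iff, eq_comm]
    · have := h (r, j)
      rw [key2 _ (fun hh => absurd hh.2 (not_le.2 hj)), sub_eq_zero, if_neg] at this
      · exact this
      · intro hh
        exact absurd (hβ.1 r) (not_le.2 (hj.trans_eq hh))
    · have := h (e.symm ⟨s, by omega⟩).1
      rw [key1 _ (e.symm ⟨s, by omega⟩).2] at this
      simpa [hs] using this
    · have := h (e.symm (Fin.last m)).1
      rw [key1 _ (e.symm (Fin.last m)).2] at this
      simpa using this

end Forms

/-! ### Tangent vectors over the dual numbers. -/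

section Tangent

variable {k n : ℕ}

/-- The tangent vector `B + ε M` over the dual numbers. -/
def dualMatrix {m : ℕ} (B M : Matrix (Fin m) (Fin n) ℂ) :
    Matrix (Fin m) (Fin n) (DualNumber ℂ) :=
  Matrix.of fun i j => TrivSqZeroExt.inl (B i j) + TrivSqZeroExt.inr (M i j)

lemma fst_dualMatrix {m : ℕ} (B M : Matrix (Fin m) (Fin n) ℂ) (i : Fin m) (j : Fin n) :
    (dualMatrix B M i j).fst = B i j := by
  simp [dualMatrix, -DualNumber.inr_eq_smul_eps]

lemma snd_dualMatrix {m : ℕ} (B M : Matrix (Fin m) (Fin n) ℂ) (i : Fin m) (j : Fin n) :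
    (dualMatrix B M i j).snd = M i j := by
  simp [dualMatrix, -DualNumber.inr_eq_smul_eps]

lemma dualMatrix_mul {l m : ℕ} (P P' : Matrix (Fin l) (Fin m) ℂ) (B M : Matrix (Fin m) (Fin n) ℂ) :
    dualMatrix P P' * dualMatrix B M = dualMatrix (P * B) (P * M + P' * B) := by
  ext i j
  · rw [fst_dualMatrix]
    simp [Matrix.mul_apply, TrivSqZeroExt.fst_sum, fst_dualMatrix]
  · rw [snd_dualMatrix]
    simp [Matrix.mul_apply, TrivSqZeroExt.snd_sum, Finset.sum_add_distrib, fst_dualMatrix,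
      snd_dualMatrix, mul_comm, add_comm]

lemma dualMatrix_zero {m : ℕ} (B : Matrix (Fin m) (Fin n) ℂ) :
    dualMatrix B 0 = B.map (algebraMap ℂ (DualNumber ℂ)) := by
  ext i j
  · rw [fst_dualMatrix]
    rfl
  · rw [snd_dualMatrix]
    rfl

lemma dualMatrix_submatrix_eq_one {B M : Matrix (Fin k) (Fin n) ℂ} {f : Fin k → Fin n} :
    (dualMatrix B M).submatrix id f = 1 ↔ B.submatrix id f = 1 ∧ M.submatrix id f = 0 := by
  have h1 : (dualMatrix B M).submatrix id f =
    dualMatrix (B.submatrix id f) (M.submatrix id f) := rfl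
  have h2 : (1 : Matrix (Fin k) (Fin k) (DualNumber ℂ)) = dualMatrix 1 0 := by
    rw [dualMatrix_zero, Matrix.map_one _ (map_zero _) (map_one _)]
  rw [h1, h2, ← Matrix.ext_iff, ← Matrix.ext_iff, ← Matrix.ext_iff, ← forall_and]
  refine forall_congr' fun i => ?_
  rw [← forall_and]
  refine forall_congr' fun j => ?_
  rw [TrivSqZeroExt.ext_iff]
  simp [dualMatrix]

/-- The Zariski tangent space at (the row space of) `B` to the intersection of `Ω_α` with the
zeroes of the first `m` incidence forms is zero. -/
def IsNondegenerate (α : PluckerIndex k n) (W : ℕ → Matrix (Fin n) (Fin k) ℂ) (m : ℕ)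
    (B : Matrix (Fin k) (Fin n) ℂ) : Prop :=
  ∀ M, InSchubert α (dualMatrix B M) → (∀ s < m, incidenceForm (W s) (dualMatrix B M) = 0) →
    ∃ G : Matrix (Fin k) (Fin k) ℂ, M = G * B

/-- Nondegeneracy depends only on the row space, not on the matrix chosen for it. -/
lemma IsNondegenerate.mul_left {α : PluckerIndex k n} {W : ℕ → Matrix (Fin n) (Fin k) ℂ} {m : ℕ}
    {B : Matrix (Fin k) (Fin n) ℂ} (h : IsNondegenerate α W m B) {P : Matrix (Fin k) (Fin k) ℂ}
    (hP : P.det ≠ 0) : IsNondegenerate α W m (P * B) := by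
  intro M h1 h2
  have hu := isUnit_iff_ne_zero.2 hP
  have h3 : dualMatrix B (P⁻¹ * M) = dualMatrix P⁻¹ 0 * dualMatrix (P * B) M := by
    rw [dualMatrix_mul, ← Matrix.mul_assoc, Matrix.nonsing_inv_mul _ hu, Matrix.one_mul,
      Matrix.zero_mul, add_zero]
  obtain ⟨G, hG⟩ := h (P⁻¹ * M) (by rw [h3]; exact h1.mul_left _)
    fun s hs => by rw [h3, incidenceForm_mul, h2 s hs, mul_zero]
  refine ⟨P * G * P⁻¹, ?_⟩
  rw [Matrix.mul_assoc, ← Matrix.mul_assoc P⁻¹, Matrix.nonsing_inv_mul _ hu, Matrix.one_mul,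
    Matrix.mul_assoc, ← hG, ← Matrix.mul_assoc, Matrix.mul_nonsing_inv _ hu, Matrix.one_mul]

/-- Nondegeneracy may be tested on tangent vectors normalized in some columns. -/
lemma isNondegenerate_of_normalized {α : PluckerIndex k n} {W : ℕ → Matrix (Fin n) (Fin k) ℂ}
    {m : ℕ} {B : Matrix (Fin k) (Fin n) ℂ} {f : Fin k → Fin n} (hB : B.submatrix id f = 1)
    (h : ∀ M, M.submatrix id f = 0 → InSchubert α (dualMatrix B M) →
      (∀ s < m, incidenceForm (W s) (dualMatrix B M) = 0) → M = 0) :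
    IsNondegenerate α W m B := by
  intro M h1 h2
  refine ⟨M.submatrix id f, ?_⟩
  have h3 : dualMatrix B (M - M.submatrix id f * B) =
      dualMatrix 1 (-(M.submatrix id f)) * dualMatrix B M := by
    rw [dualMatrix_mul, Matrix.one_mul, Matrix.one_mul, Matrix.neg_mul, sub_eq_add_neg]
  rw [← sub_eq_zero]
  refine h _ ?_ (by rw [h3]; exact h1.mul_left _) fun s hs => by
    rw [h3, incidenceForm_mul, h2 s hs, mul_zero]
  have h4 : (M.submatrix id f * B).submatrix id f = M.submatrix id f * B.submatrix id f := rfl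
  change M.submatrix id f - (M.submatrix id f * B).submatrix id f = 0
  rw [h4, hB, Matrix.mul_one, sub_self]

lemma IsNondegenerate.eq_zero {α : PluckerIndex k n} {W : ℕ → Matrix (Fin n) (Fin k) ℂ}
    {m : ℕ} {B M : Matrix (Fin k) (Fin n) ℂ} {f : Fin k → Fin n} (h : IsNondegenerate α W m B)
    (hB : B.submatrix id f = 1) (hM : M.submatrix id f = 0) (h1 : InSchubert α (dualMatrix B M))
    (h2 : ∀ s < m, incidenceForm (W s) (dualMatrix B M) = 0) : M = 0 := by
  obtain ⟨G, rfl⟩ := h M h1 h2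
  have h4 : (G * B).submatrix id f = G * B.submatrix id f := rfl
  rw [h4, hB, Matrix.mul_one] at hM
  rw [hM, Matrix.zero_mul]

end Tangent

/-! ### Differentials of polynomial maps and the inverse function theorem. -/

section PolynomialMaps

variable {ρ : Type*} [Fintype ρ]

lemma hasStrictFDerivAt_mvPolynomial (f : MvPolynomial ρ ℂ) (y : ρ → ℂ) :
    HasStrictFDerivAt (fun y : ρ → ℂ => MvPolynomial.eval y f)
      (∑ s, polyDifferential f y s •
        (ContinuousLinearMap.proj s : (ρ → ℂ) →L[ℂ] ℂ)) y := by
  classical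
  induction f using MvPolynomial.induction_on with
  | C a =>
    simp only [MvPolynomial.eval_C]
    refine (hasStrictFDerivAt_const (𝕜 := ℂ) a y).congr_fderiv ?_
    ext v
    simp [polyDifferential]
  | add p q hp hq =>
    have h1 := hp.add hq
    have h2 : HasStrictFDerivAt (fun y => MvPolynomial.eval y (p + q))
        (∑ s, polyDifferential p y s • (ContinuousLinearMap.proj s : (ρ → ℂ) →L[ℂ] ℂ) +
          ∑ s, polyDifferential q y s • (ContinuousLinearMap.proj s : (ρ → ℂ) →L[ℂ] ℂ)) y := by
      simp only [map_add]
      exact h1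
    refine h2.congr_fderiv ?_
    ext v
    simp [polyDifferential, add_mul, Finset.sum_add_distrib]
  | mul_X p i hp =>
    have h1 := hp.mul (ContinuousLinearMap.proj (R := ℂ) (φ := fun _ : ρ => ℂ) i).hasStrictFDerivAt
      (x := y)
    simp only [map_mul, MvPolynomial.eval_X]
    refine h1.congr_fderiv ?_
    ext v
    simp only [polyDifferential, add_apply, smul_apply,
      ContinuousLinearMap.proj_apply, sum_apply, smul_eq_mul,
      Derivation.leibniz, map_add, MvPolynomial.pderiv_X, map_mul, MvPolynomial.eval_X,
      add_mul, Finset.sum_add_distrib, Finset.mul_sum]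
    congr 1
    · rw [Finset.sum_eq_single i]
      · simp
      · intro b _ hb
        simp [hb.symm]
      · simp
    · exact Finset.sum_congr rfl fun s _ => by ring

/-- Taylor expansion to first order, exact because `ε² = 0`. -/
lemma aeval_dualNumber (f : MvPolynomial ρ ℂ) (y v : ρ → ℂ) :
    MvPolynomial.aeval (R := ℂ) (fun s => (TrivSqZeroExt.inl (y s) + TrivSqZeroExt.inr (v s) :
      DualNumber ℂ)) f =
      TrivSqZeroExt.inl (MvPolynomial.eval y f) +
        TrivSqZeroExt.inr (∑ s, polyDifferential f y s * v s) := by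
  classical
  induction f using MvPolynomial.induction_on with
  | C a =>
    simp only [MvPolynomial.aeval_C, polyDifferential, MvPolynomial.eval_C, MvPolynomial.pderiv_C,
      map_zero, zero_mul, Finset.sum_const_zero, TrivSqZeroExt.inr_zero, add_zero]
    rfl
  | add p q hp hq =>
    rw [map_add, hp, hq]
    simp only [polyDifferential, map_add, add_mul, Finset.sum_add_distrib, TrivSqZeroExt.inl_add,
      TrivSqZeroExt.inr_add]
    abel
  | mul_X p i hp =>
    rw [map_mul, hp, MvPolynomial.aeval_X]
    have h1 : ∑ s, polyDifferential (p * MvPolynomial.X i) y s * v s =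
        MvPolynomial.eval y p * v i + (∑ s, polyDifferential p y s * v s) * y i := by
      simp only [polyDifferential, Derivation.leibniz, map_add, MvPolynomial.pderiv_X, map_mul,
        MvPolynomial.eval_X, smul_eq_mul, add_mul, Finset.sum_add_distrib, Finset.sum_mul]
      congr 1
      · rw [Finset.sum_eq_single i]
        · simp
        · intro b _ hb
          simp [hb.symm]
        · simp
      · exact Finset.sum_congr rfl fun s _ => by ring
    rw [h1]
    ext
    · simp [-DualNumber.inr_eq_smul_eps]
    · simp [-DualNumber.inr_eq_smul_eps]

/-- The inverse function theorem for a square polynomial map. -/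
lemma polynomialMap_local (F : ρ → MvPolynomial ρ ℂ) (y₀ : ρ → ℂ)
    (h : ∀ v : ρ → ℂ, (∀ i, ∑ s, polyDifferential (F i) y₀ s * v s = 0) → v = 0) :
    map (fun (y : ρ → ℂ) i => MvPolynomial.eval y (F i)) (𝓝 y₀) =
        𝓝 (fun i => MvPolynomial.eval y₀ (F i)) ∧
      (∃ U ∈ 𝓝 y₀, Set.InjOn (fun (y : ρ → ℂ) i => MvPolynomial.eval y (F i)) U) ∧
      ∀ᶠ y in 𝓝 y₀, ∀ v : ρ → ℂ,
        (∀ i, ∑ s, polyDifferential (F i) y s * v s = 0) → v = 0 := by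
  classical
  let J : (ρ → ℂ) → Matrix ρ ρ ℂ := fun y => Matrix.of fun i s => polyDifferential (F i) y s
  have hJv : ∀ y v, (J y).mulVec v = 0 ↔ ∀ i, ∑ s, polyDifferential (F i) y s * v s = 0 :=
    fun y v => funext_iff
  have hdet : ∀ y, (J y).det ≠ 0 ↔
      ∀ v : ρ → ℂ, (∀ i, ∑ s, polyDifferential (F i) y s * v s = 0) → v = 0 := by
    intro y
    rw [Ne, ← Matrix.exists_mulVec_eq_zero_iff]
    simp only [hJv]
    exact ⟨fun hn v hv => by_contra fun hv0 => hn ⟨v, hv0, hv⟩,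
      fun hn ⟨v, hv0, hv⟩ => hv0 (hn v hv)⟩
  have hinj : Function.Injective (Matrix.toLin' (J y₀)) := by
    rw [← LinearMap.ker_eq_bot, LinearMap.ker_eq_bot']
    intro v hv
    rw [Matrix.toLin'_apply] at hv
    exact h v ((hJv y₀ v).1 hv)
  obtain ⟨E, hE⟩ : ∃ E : (ρ → ℂ) ≃L[ℂ] (ρ → ℂ), ∀ v, E v = (J y₀).mulVec v :=
    ⟨(LinearEquiv.ofInjectiveEndo _ hinj).toContinuousLinearEquiv, fun v => by simp⟩
  have hder : HasStrictFDerivAt (fun (y : ρ → ℂ) i => MvPolynomial.eval y (F i))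
      (E : (ρ → ℂ) →L[ℂ] (ρ → ℂ)) y₀ := by
    rw [hasStrictFDerivAt_pi']
    intro i
    refine (hasStrictFDerivAt_mvPolynomial (F i) y₀).congr_fderiv ?_
    ext v
    simp [hE, J, Matrix.mulVec, dotProduct]
  refine ⟨hder.map_nhds_eq_of_equiv, ?_, ?_⟩
  · refine ⟨_, (hder.toOpenPartialHomeomorph _).open_source.mem_nhds
      hder.mem_toOpenPartialHomeomorph_source, ?_⟩
    have := (hder.toOpenPartialHomeomorph _).injOn
    rwa [hder.toOpenPartialHomeomorph_coe] at this
  · have hcont : Continuous fun y => (J y).det := by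
      refine Continuous.matrix_det ?_
      refine continuous_matrix fun i s => ?_
      exact MvPolynomial.continuous_eval _
    have := hcont.continuousAt.eventually_ne ((hdet y₀).2 h)
    filter_upwards [this] with y hy
    exact (hdet y).1 hy

end PolynomialMaps

/-! ### Continuation of one solution from `Ω_β` to `Ω_α`. -/

section LocalDegeneration

variable {k n : ℕ}

lemma matrixPoint_dualMatrix (x M : Matrix (Fin k) (Fin n) ℂ) (τ : ℂ) :
    matrixPoint (dualMatrix x M) (algebraMap ℂ (DualNumber ℂ) τ) =
      fun s => (TrivSqZeroExt.inl (matrixPoint x τ s) + TrivSqZeroExt.inr (matrixPoint M 0 s) :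
        DualNumber ℂ) := by
  funext s
  cases s with
  | none =>
    simp only [matrixPoint, TrivSqZeroExt.inr_zero, add_zero]
    rfl
  | some p => rfl

/-- The `ε`-part of the system at `x + ε M` is its differential applied to `M`. The equation at
`none` forces the `τ`-component of a kernel vector to vanish. -/
lemma chartSystem_nondegenerate_iff (Q : Matrix (Fin n) (Fin k) ℝ)
    (W : ℕ → Matrix (Fin n) (Fin k) ℂ) {α β : PluckerIndex k n} (hβ : Interlaces β α) {m : ℕ}
    (e : {p : Fin k × Fin n // p.2 ∉ Set.range β.1 ∧ p.2 ≤ α.1 p.1} ≃ Fin (m + 1))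
    {τ : ℂ} {x : Matrix (Fin k) (Fin n) ℂ} (hx : IsChartSolution Q W α β m τ x) :
    (∀ v : Option (Fin k × Fin n) → ℂ, (∀ i, ∑ s,
        polyDifferential (chartSystem Q W α β m e i) (matrixPoint x τ) s * v s = 0) → v = 0) ↔
      ∀ M, IsChartSolution Q W α β m (algebraMap ℂ (DualNumber ℂ) τ) (dualMatrix x M) →
        M = 0 := by
  have hx' := (isChartSolution_iff Q W hβ m e τ x).1 hx
  have hsnd : ∀ (M : Matrix (Fin k) (Fin n) ℂ) i, ∑ s,
      polyDifferential (chartSystem Q W α β m e i) (matrixPoint x τ) s * matrixPoint M 0 s =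
      (MvPolynomial.aeval (R := ℂ) (matrixPoint (dualMatrix x M)
        (algebraMap ℂ (DualNumber ℂ) τ)) (chartSystem Q W α β m e i)).snd := by
    intro M i
    rw [matrixPoint_dualMatrix, aeval_dualNumber]
    simp [-DualNumber.inr_eq_smul_eps]
  have hfst : ∀ (M : Matrix (Fin k) (Fin n) ℂ) p,
      (MvPolynomial.aeval (R := ℂ) (matrixPoint (dualMatrix x M)
        (algebraMap ℂ (DualNumber ℂ) τ)) (chartSystem Q W α β m e (some p))).fst = 0 := by
    intro M p
    rw [matrixPoint_dualMatrix, aeval_dualNumber]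
    simpa [-DualNumber.inr_eq_smul_eps, MvPolynomial.coe_aeval_eq_eval] using hx' p
  constructor
  · intro h M hM
    rw [isChartSolution_iff Q W hβ m e] at hM
    have h1 : matrixPoint M 0 = 0 := by
      refine h _ fun i => ?_
      rw [hsnd]
      cases i with
      | none =>
        simp only [chartSystem, MvPolynomial.aeval_X, matrixPoint]
        rfl
      | some p => rw [hM p, TrivSqZeroExt.snd_zero]
    ext r j
    exact congrFun h1 (some (r, j))
  · intro h v hv
    have h0 : v none = 0 := by
      classical
      have := hv none
      rw [Finset.sum_eq_single none] at this
      · simpa [chartSystem, polyDifferential] using this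
      · intro b _ hb
        simp [chartSystem, polyDifferential, MvPolynomial.pderiv_X, hb.symm]
      · simp
    obtain ⟨M, rfl⟩ : ∃ M : Matrix (Fin k) (Fin n) ℂ, v = matrixPoint M 0 := by
      refine ⟨Matrix.of fun r j => v (some (r, j)), funext fun s => ?_⟩
      cases s with
      | none => exact h0
      | some p => rfl
    have hM : M = 0 := by
      refine h M ((isChartSolution_iff Q W hβ m e _ _).2 fun p => ?_)
      refine TrivSqZeroExt.ext (hfst M p) ?_
      rw [← hsnd, hv, TrivSqZeroExt.snd_zero]
    funext s
    cases s with
    | none => rfl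
    | some p => rw [hM]; rfl

lemma continuous_matrixPoint :
    Continuous fun p : Matrix (Fin k) (Fin n) ℂ × ℂ => matrixPoint p.1 p.2 := by
  refine continuous_pi fun s => ?_
  cases s with
  | none => exact continuous_snd
  | some p => exact continuous_fst.matrix_elem p.1 p.2

/-- At `τ = 0` the last equation is `p_α = 0`, which in this chart defines `Ω_β` even over the dual
numbers. So nondegeneracy of `N` on `Ω_β` makes the Jacobian of the square system invertible. -/
theorem local_degeneration {α β : PluckerIndex k n} (hβ : β ⋖ α) {m : ℕ} (hm : α.size = m + 1)
    (Q : Matrix (Fin n) (Fin k) ℝ) (hq : rowMinor Q α ≠ 0) (W : ℕ → Matrix (Fin n) (Fin k) ℂ)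
    {N : Matrix (Fin k) (Fin n) ℂ} (hN : N.submatrix id β.1 = 1) (hS : InSchubert β N)
    (hW : ∀ s < m, incidenceForm (W s) N = 0) (hnd : IsNondegenerate β W m N) :
    (∀ U ∈ 𝓝 N, ∀ᶠ τ in 𝓝 (0 : ℂ), ∃ x ∈ U, IsChartSolution Q W α β m τ x) ∧
    ∃ U ∈ 𝓝 N, ∀ᶠ τ in 𝓝 (0 : ℂ), ∀ x ∈ U, IsChartSolution Q W α β m τ x →
      (∀ y ∈ U, IsChartSolution Q W α β m τ y → y = x) ∧
      ∀ M, IsChartSolution Q W α β m (algebraMap ℂ (DualNumber ℂ) τ) (dualMatrix x M) →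
        M = 0 := by
  have hint := interlaces_of_covBy hβ
  obtain ⟨e⟩ : Nonempty
      ({p : Fin k × Fin n // p.2 ∉ Set.range β.1 ∧ p.2 ≤ α.1 p.1} ≃ Fin (m + 1)) := by
    refine Fintype.card_eq.1 ?_
    rw [card_interlaced hint, hm, Fintype.card_fin]
  have hlt : ∀ R : Type, ∀ [CommRing R] [Algebra ℂ R], ∀ B : Matrix (Fin k) (Fin n) R,
      degenerationForm Q α 0 B = 0 ↔ colMinor B α.1 = 0 := by
    intro R _ _ B
    rw [degenerationForm_zero]
    exact IsUnit.mul_right_eq_zero ((IsUnit.mk0 _ hq).map (algebraMap ℂ R))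
  have hsolN : IsChartSolution Q W α β m (0 : ℂ) N :=
    ⟨hN, hS.mono hβ.le, hW, (hlt ℂ N).2 (hS α hβ.lt.not_ge)⟩
  have hnd0 : ∀ M, IsChartSolution Q W α β m (algebraMap ℂ (DualNumber ℂ) 0) (dualMatrix N M) →
      M = 0 := by
    rintro M ⟨h1, h2, h3, h4⟩
    rw [map_zero] at h4
    exact hnd.eq_zero hN (dualMatrix_submatrix_eq_one.1 h1).2
      (h2.of_covBy hβ h1 ((hlt _ _).1 h4)) h3
  obtain ⟨hmap, ⟨U, hU, hinj⟩, hev⟩ := polynomialMap_local (chartSystem Q W α β m e)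
    (matrixPoint N 0) ((chartSystem_nondegenerate_iff Q W hint e hsolN).2 hnd0)
  set F : (Option (Fin k × Fin n) → ℂ) → Option (Fin k × Fin n) → ℂ :=
    fun y i => MvPolynomial.eval y (chartSystem Q W α β m e i) with hF
  -- Since `τ` is a coordinate of the system, the solutions at `τ` form the fibre over the point
  -- with coordinate `τ` and zeros elsewhere.
  have hFsol : ∀ x τ, IsChartSolution Q W α β m τ x ↔ F (matrixPoint x τ) = matrixPoint 0 τ := by
    intro x τ
    rw [isChartSolution_iff Q W hint m e, funext_iff, Option.forall]
    simp [hF, chartSystem, matrixPoint]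
  rw [show (fun i => MvPolynomial.eval (matrixPoint N 0) (chartSystem Q W α β m e i)) =
    matrixPoint 0 0 from (hFsol N 0).1 hsolN] at hmap
  constructor
  · intro V hV
    have hV' : {y : Option (Fin k × Fin n) → ℂ | (Matrix.of fun r j => y (some (r, j))) ∈ V} ∈
        𝓝 (matrixPoint N 0) := by
      have hc : Continuous fun y : Option (Fin k × Fin n) → ℂ =>
          (Matrix.of fun r j => y (some (r, j)) : Matrix (Fin k) (Fin n) ℂ) :=
        continuous_matrix fun r j => continuous_apply (some (r, j))
      exact hc.continuousAt.preimage_mem_nhds hV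
    have h1 := image_mem_map (m := F) hV'
    rw [hmap] at h1
    have hc : Continuous fun τ : ℂ => matrixPoint (0 : Matrix (Fin k) (Fin n) ℂ) τ :=
      continuous_matrixPoint.comp (continuous_const.prodMk continuous_id)
    filter_upwards [hc.continuousAt.preimage_mem_nhds h1] with τ hτ
    obtain ⟨y, hy, hyτ⟩ := hτ
    have hy0 : y none = τ := by simpa [hF, chartSystem, matrixPoint] using congrFun hyτ none
    refine ⟨_, hy, (hFsol _ _).2 ?_⟩
    refine Eq.trans (congrArg F ?_) hyτ
    funext s
    cases s with
    | none => exact hy0.symm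
    | some p => rfl
  · have h1 : ∀ᶠ p : Matrix (Fin k) (Fin n) ℂ × ℂ in 𝓝 (N, 0), matrixPoint p.1 p.2 ∈ U ∧
        ∀ v : Option (Fin k × Fin n) → ℂ, (∀ i, ∑ s,
          polyDifferential (chartSystem Q W α β m e i) (matrixPoint p.1 p.2) s * v s = 0) →
          v = 0 :=
      (continuous_matrixPoint.tendsto (N, (0 : ℂ))).eventually
        ((eventually_mem_set.2 hU).and hev)
    rw [nhds_prod_eq, eventually_prod_iff] at h1
    obtain ⟨pa, hpa, pb, hpb, hp⟩ := h1
    refine ⟨{x | pa x}, hpa, ?_⟩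
    filter_upwards [hpb] with τ hτ x hx hsx
    refine ⟨fun y hy hsy => ?_, (chartSystem_nondegenerate_iff Q W hint e hsx).1 (hp hx hτ).2⟩
    have h2 := hinj (hp hy hτ).1 (hp hx hτ).1 (((hFsol _ _).1 hsy).trans ((hFsol _ _).1 hsx).symm)
    ext r j
    exact congrFun h2 (some (r, j))

end LocalDegeneration

/-! ### Limits of solutions as the parameter tends to zero. -/

section Degeneration

variable {k n : ℕ}

/-- The solutions of the Schubert problem on `Ω_α`, normalized in the columns `α`. -/
def normalizedSolutions (W : ℕ → Matrix (Fin n) (Fin k) ℂ) (α : PluckerIndex k n) :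
    Set (Matrix (Fin k) (Fin n) ℂ) :=
  {B | B.submatrix id α.1 = 1 ∧ InSchubert α B ∧ ∀ s < α.size, incidenceForm (W s) B = 0}

/-- The Schubert problem on `Ω_α` has the expected number of solutions, which are real and
nondegenerate. -/
structure HasRealSolutions (W : ℕ → Matrix (Fin n) (Fin k) ℂ) (α : PluckerIndex k n) : Prop where
  finite : (normalizedSolutions W α).Finite
  ncard_eq : (normalizedSolutions W α).ncard = chainCount α
  real : ∀ B ∈ normalizedSolutions W α, B.map (starRingEnd ℂ) = B
  nondegenerate : ∀ B ∈ normalizedSolutions W α, IsNondegenerate α W α.size B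

/-- The overdetermined Schubert problem with `|α| + 1` conditions on `Ω_α` has no solutions. -/
def HasNoExcessSolutions (W : ℕ → Matrix (Fin n) (Fin k) ℂ) (α : PluckerIndex k n) : Prop :=
  ∀ B : Matrix (Fin k) (Fin n) ℂ, (∃ γ : PluckerIndex k n, colMinor B γ.1 ≠ 0) →
    InSchubert α B → ¬ ∀ s < α.size + 1, incidenceForm (W s) B = 0

lemma HasRealSolutions.congr {W W' : ℕ → Matrix (Fin n) (Fin k) ℂ} {α : PluckerIndex k n}
    (h : HasRealSolutions W α) (hW : ∀ s < α.size, W s = W' s) : HasRealSolutions W' α := by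
  have h1 : normalizedSolutions W' α = normalizedSolutions W α := by
    ext B
    refine and_congr_right fun _ => and_congr_right fun _ => forall₂_congr fun s hs => ?_
    rw [hW s hs]
  refine ⟨h1 ▸ h.finite, h1 ▸ h.ncard_eq, h1 ▸ h.real, fun B hB M hM hM' => ?_⟩
  exact h.nondegenerate B (h1 ▸ hB) M hM fun s hs => by rw [hW s hs]; exact hM' s hs

lemma HasNoExcessSolutions.congr {W W' : ℕ → Matrix (Fin n) (Fin k) ℂ} {α : PluckerIndex k n}
    (h : HasNoExcessSolutions W α) (hW : ∀ s < α.size + 1, W s = W' s) :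
    HasNoExcessSolutions W' α := fun B hB hS hB' =>
  h B hB hS fun s hs => by rw [hW s hs]; exact hB' s hs

/-- A solution with `p_α = 0` would lie on some `Ω_β` with `β ⋖ α` and satisfy `|β| + 1` conditions
there. -/
lemma colMinor_ne_zero_of_hasNoExcessSolutions {W : ℕ → Matrix (Fin n) (Fin k) ℂ}
    {α : PluckerIndex k n} (h : ∀ β, β ⋖ α → HasNoExcessSolutions W β)
    {B : Matrix (Fin k) (Fin n) ℂ} (hB : ∃ γ : PluckerIndex k n, colMinor B γ.1 ≠ 0)
    (hS : InSchubert α B) (hW : ∀ s < α.size, incidenceForm (W s) B = 0) :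
    colMinor B α.1 ≠ 0 := by
  intro h0
  obtain ⟨β, hβ, hβB⟩ := hS.exists_covBy hB h0
  refine h β hβ B hB hβB fun s hs => hW s ?_
  rwa [← size_of_covBy hβ]

lemma normalize_mem_normalizedSolutions {W : ℕ → Matrix (Fin n) (Fin k) ℂ}
    {α : PluckerIndex k n} {B : Matrix (Fin k) (Fin n) ℂ} (hB : colMinor B α.1 ≠ 0)
    (hS : InSchubert α B) (hW : ∀ s < α.size, incidenceForm (W s) B = 0) :
    normalize α B ∈ normalizedSolutions W α :=
  ⟨normalize_submatrix hB, hS.mul_left _, fun s hs => by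
    rw [normalize, incidenceForm_mul, hW s hs, mul_zero]⟩

lemma continuous_colMinor (f : Fin k → Fin n) :
    Continuous fun B : Matrix (Fin k) (Fin n) ℂ => colMinor B f :=
  (continuous_id.matrix_submatrix id f).matrix_det

lemma continuous_incidenceForm (W : Matrix (Fin n) (Fin k) ℂ) :
    Continuous fun B : Matrix (Fin k) (Fin n) ℂ => incidenceForm W B :=
  (continuous_id.matrix_mul continuous_const).matrix_det

lemma continuous_degenerationForm (Q : Matrix (Fin n) (Fin k) ℝ) (α : PluckerIndex k n) :
    Continuous fun p : ℂ × Matrix (Fin k) (Fin n) ℂ => degenerationForm Q α p.1 p.2 := by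
  refine continuous_finsetSum _ fun γ _ => ?_
  split_ifs
  · exact (continuous_const.mul (continuous_fst.pow _)).mul
      ((continuous_colMinor γ.1).comp continuous_snd)
  · exact continuous_const

lemma continuous_degenerationForm_left (Q : Matrix (Fin n) (Fin k) ℝ) (α : PluckerIndex k n)
    (B : Matrix (Fin k) (Fin n) ℂ) : Continuous fun τ : ℂ => degenerationForm Q α τ B := by
  refine continuous_finsetSum _ fun γ _ => ?_
  split_ifs <;> fun_prop

lemma continuousAt_normalize {γ : PluckerIndex k n} {B : Matrix (Fin k) (Fin n) ℂ}
    (hB : colMinor B γ.1 ≠ 0) : ContinuousAt (normalize γ) B := by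
  have h1 : (normalize γ : Matrix (Fin k) (Fin n) ℂ → _) = fun B =>
      (colMinor B γ.1)⁻¹ • ((B.submatrix id γ.1).adjugate * B) := by
    funext B
    rw [normalize, Matrix.inv_def, Ring.inverse_eq_inv', Matrix.smul_mul]
    rfl
  rw [h1]
  exact ((continuous_colMinor γ.1).continuousAt.inv₀ hB).smul
    ((continuous_id.matrix_submatrix id γ.1).matrix_adjugate.matrix_mul
      continuous_id).continuousAt

/-- The first `|β|` conditions leave finitely many points, all with `p_β = 1` after normalization.
The rescaled new form tends to `q_β ≠ 0` at each of them. -/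
lemma eventually_hasNoExcessSolutions (Q : Matrix (Fin n) (Fin k) ℝ)
    {W : ℕ → Matrix (Fin n) (Fin k) ℂ} {β : PluckerIndex k n} (hq : rowMinor Q β ≠ 0)
    (hfin : (normalizedSolutions W β).Finite) (h : ∀ γ, γ ⋖ β → HasNoExcessSolutions W γ) :
    ∀ᶠ τ in 𝓝 (0 : ℂ), τ ≠ 0 →
      HasNoExcessSolutions (Function.update W β.size (scaledEquations Q τ)) β := by
  have h1 : ∀ᶠ τ in 𝓝 (0 : ℂ), ∀ N ∈ normalizedSolutions W β, degenerationForm Q β τ N ≠ 0 := by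
    rw [eventually_all_finite hfin]
    intro N hN
    have hc := continuous_degenerationForm_left Q β N
    have h0 : degenerationForm Q β 0 N ≠ 0 := by
      rw [degenerationForm_zero, colMinor_eq_one hN.1, mul_one]
      exact hq
    exact hc.continuousAt.eventually_ne h0
  filter_upwards [h1] with τ hτ hτ0 B hB hS hW
  have hW' : ∀ s < β.size, incidenceForm (W s) B = 0 := fun s hs => by
    have := hW s (by omega)
    rwa [Function.update_of_ne hs.ne] at this
  have hne := colMinor_ne_zero_of_hasNoExcessSolutions h hB hS hW'
  have hN := normalize_mem_normalizedSolutions hne hS hW'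
  refine hτ _ hN ((degenerationForm_eq_zero_iff Q hτ0 hN.2.1).2 ?_)
  have := hW β.size (by omega)
  rw [Function.update_self] at this
  rw [normalize, incidenceForm_mul, this, mul_zero]

/-- The matrices normalized in the columns `γ` with entries in the unit disk. -/
def boundedChart (γ : PluckerIndex k n) : Set (Matrix (Fin k) (Fin n) ℂ) :=
  {y | y.submatrix id γ.1 = 1 ∧ ∀ r j, ‖y r j‖ ≤ 1}

lemma isCompact_boundedChart (γ : PluckerIndex k n) : IsCompact (boundedChart γ) := by
  have h1 : IsCompact {y : Fin k → Fin n → ℂ | ∀ r, y r ∈ {z : Fin n → ℂ | ∀ j,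
      z j ∈ Metric.closedBall (0 : ℂ) 1}} :=
    isCompact_pi_infinite fun _ => isCompact_pi_infinite fun _ => isCompact_closedBall 0 1
  have h2 : IsCompact {y : Matrix (Fin k) (Fin n) ℂ | ∀ r j, ‖y r j‖ ≤ 1} := by
    have heq : {y : Fin k → Fin n → ℂ | ∀ r j, ‖y r j‖ ≤ 1} =
        {y : Fin k → Fin n → ℂ | ∀ r, y r ∈ {z : Fin n → ℂ | ∀ j,
          z j ∈ Metric.closedBall (0 : ℂ) 1}} := by
      ext y
      simp
    rw [← heq] at h1
    exact h1
  have h3 : IsClosed {y : Matrix (Fin k) (Fin n) ℂ | y.submatrix id γ.1 = 1} :=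
    isClosed_eq (continuous_id.matrix_submatrix id γ.1) continuous_const
  exact h2.inter_left h3

/-- Normalize at the minor of largest modulus: all entries become quotients of minors by it, up to
sign, or zero. Thus finitely many compact charts cover the Grassmannian. -/
lemma exists_normalize_mem_boundedChart {B : Matrix (Fin k) (Fin n) ℂ}
    (hB : ∃ γ : PluckerIndex k n, colMinor B γ.1 ≠ 0) :
    ∃ γ : PluckerIndex k n, colMinor B γ.1 ≠ 0 ∧ normalize γ B ∈ boundedChart γ := by
  obtain ⟨γ₀, hγ₀⟩ := hB
  obtain ⟨γ, -, hmax⟩ := Finset.exists_max_image Finset.univ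
    (fun γ : PluckerIndex k n => ‖colMinor B γ.1‖) ⟨γ₀, Finset.mem_univ _⟩
  have hγ : colMinor B γ.1 ≠ 0 := by
    rw [← norm_pos_iff] at hγ₀ ⊢
    exact hγ₀.trans_le (hmax γ₀ (Finset.mem_univ _))
  have hN := normalize_submatrix hγ
  refine ⟨γ, hγ, hN, fun r j => ?_⟩
  rw [← colMinor_update hN]
  by_cases hinj : Function.Injective (Function.update γ.1 r j)
  · obtain ⟨δ, σ, hσ⟩ := exists_sorted hinj
    have h1 : colMinor B γ.1 * colMinor (normalize γ B) δ.1 = colMinor B δ.1 := by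
      conv_rhs => rw [eq_mul_normalize hγ, colMinor_mul]
      rfl
    have h2 : ‖((Equiv.Perm.sign σ : ℤ) : ℂ)‖ = 1 := by
      rcases Int.units_eq_one_or (Equiv.Perm.sign σ) with h | h <;> simp [h]
    rw [hσ, colMinor_comp_perm, norm_mul, h2, one_mul]
    have h3 : ‖colMinor B δ.1‖ ≤ ‖colMinor B γ.1‖ := hmax δ (Finset.mem_univ _)
    rw [← h1, norm_mul] at h3
    exact le_of_mul_le_mul_left (by rwa [mul_one]) (norm_pos_iff.2 hγ)
  · rw [colMinor_of_not_injective _ hinj]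
    simp

/-- As `τ → 0` the solutions on `Ω_α` tend to solutions on the `Ω_β` for `β` covered by `α`. -/
lemma eventually_solutions_near (Q : Matrix (Fin n) (Fin k) ℝ)
    {W : ℕ → Matrix (Fin n) (Fin k) ℂ} {α : PluckerIndex k n} {m : ℕ} (hm : α.size = m + 1)
    (hq : rowMinor Q α ≠ 0) (h : ∀ γ : PluckerIndex k n, γ.size < m → HasNoExcessSolutions W γ)
    {V : PluckerIndex k n → Matrix (Fin k) (Fin n) ℂ → Set (Matrix (Fin k) (Fin n) ℂ)}
    (hV : ∀ β, β ⋖ α → ∀ N ∈ normalizedSolutions W β, V β N ∈ 𝓝 N) :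
    ∀ᶠ τ in 𝓝 (0 : ℂ), ∀ C : Matrix (Fin k) (Fin n) ℂ,
      (∃ γ : PluckerIndex k n, colMinor C γ.1 ≠ 0) → InSchubert α C →
      (∀ s < m, incidenceForm (W s) C = 0) → degenerationForm Q α τ C = 0 →
      ∃ β, β ⋖ α ∧ colMinor C β.1 ≠ 0 ∧
        ∃ N ∈ normalizedSolutions W β, normalize β C ∈ V β N := by
  have key : ∀ᶠ τ in 𝓝 (0 : ℂ), ∀ γ : PluckerIndex k n, ∀ C ∈ boundedChart γ, InSchubert α C →
      (∀ s < m, incidenceForm (W s) C = 0) → degenerationForm Q α τ C = 0 →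
      ∃ β, β ⋖ α ∧ colMinor C β.1 ≠ 0 ∧
        ∃ N ∈ normalizedSolutions W β, normalize β C ∈ V β N := by
    rw [eventually_all]
    intro γ
    -- By compactness it is enough to work near each `(0, y)`. If `y` violates an equation at `τ =
    -- 0`, there are no solutions nearby; otherwise `y` lies on some `Ω_β`.
    refine (isCompact_boundedChart γ).eventually_forall_of_forall_eventually fun y hy => ?_
    have hc : ∀ {f : Matrix (Fin k) (Fin n) ℂ → ℂ}, Continuous f → f y ≠ 0 →
        ∀ᶠ z : ℂ × Matrix (Fin k) (Fin n) ℂ in 𝓝 (0, y), f z.2 ≠ 0 := fun hf h0 =>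
      (hf.comp continuous_snd).continuousAt.eventually_ne h0
    by_cases h1 : InSchubert α y
    swap
    · simp only [InSchubert, not_forall] at h1
      obtain ⟨δ, hδ, h1⟩ := h1
      filter_upwards [hc (continuous_colMinor δ.1) h1] with z hz hS
      exact absurd (hS δ hδ) hz
    by_cases h2 : ∀ s < m, incidenceForm (W s) y = 0
    swap
    · simp only [not_forall] at h2
      obtain ⟨s, hs, h2⟩ := h2
      filter_upwards [hc (continuous_incidenceForm (W s)) h2] with z hz _ hS
      exact absurd (hS s hs) hz
    by_cases h3 : degenerationForm Q α 0 y = 0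
    swap
    · filter_upwards [(continuous_degenerationForm Q α).continuousAt.eventually_ne
        (x := ((0 : ℂ), y)) h3] with z hz _ _ hS
      exact absurd hS hz
    have hfull : ∃ γ : PluckerIndex k n, colMinor y γ.1 ≠ 0 :=
      ⟨γ, by rw [colMinor_eq_one hy.1]; exact one_ne_zero⟩
    rw [degenerationForm_zero] at h3
    obtain ⟨β, hβ, hS⟩ := h1.exists_covBy hfull ((mul_eq_zero.1 h3).resolve_left hq)
    have hsize := size_of_covBy hβ
    obtain rfl : β.size = m := by omega
    -- The absence of excess solutions below `β` puts `y` in the open cell of `Ω_β`, so it can be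
    -- normalized in the columns `β`.
    have hne := colMinor_ne_zero_of_hasNoExcessSolutions
      (fun δ hδ => h δ (PluckerIndex.size_lt hδ.lt)) hfull hS h2
    have hN := normalize_mem_normalizedSolutions hne hS h2
    have h4 : ∀ᶠ z : ℂ × Matrix (Fin k) (Fin n) ℂ in 𝓝 (0, y),
        normalize β z.2 ∈ V β (normalize β y) :=
      (ContinuousAt.comp (x := ((0 : ℂ), y)) (g := normalize β) (f := Prod.snd)
        (continuousAt_normalize hne) continuousAt_snd).preimage_mem_nhds (hV β hβ _ hN)
    filter_upwards [h4, hc (continuous_colMinor β.1) hne] with z hz hz' _ _ _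
    exact ⟨β, hβ, hz', _, hN, hz⟩
  filter_upwards [key] with τ hτ C hC hS hW hD
  obtain ⟨γ, hγ, hmem⟩ := exists_normalize_mem_boundedChart hC
  have hdet : ((C.submatrix id γ.1)⁻¹).det ≠ 0 := by
    rw [Matrix.det_nonsing_inv, Ring.inverse_eq_inv']
    exact inv_ne_zero hγ
  have hD' : degenerationForm Q α τ (normalize γ C) =
      ((C.submatrix id γ.1)⁻¹).det * degenerationForm Q α τ C := by
    simp only [degenerationForm, Finset.mul_sum, normalize, colMinor_mul]
    refine Finset.sum_congr rfl fun δ _ => ?_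
    split_ifs <;> ring
  obtain ⟨β, hβ, hne, N, hN, hNV⟩ := hτ γ _ hmem (hS.mul_left _)
    (fun s hs => by rw [normalize, incidenceForm_mul, hW s hs, mul_zero])
    (by rw [hD', hD, mul_zero])
  refine ⟨β, hβ, ?_, N, hN, ?_⟩
  · rw [normalize, colMinor_mul] at hne
    exact right_ne_zero_of_mul hne
  · have h5 : normalize β (normalize γ C) = normalize β C := normalize_mul _ hdet C
    rwa [h5] at hNV

end Degeneration

/-! ### Counting and reality in the inductive step. -/

section DegenerationStep

variable {k n : ℕ}

lemma colMinor_conj (B : Matrix (Fin k) (Fin n) ℂ) (f : Fin k → Fin n) :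
    colMinor (B.map (starRingEnd ℂ)) f = starRingEnd ℂ (colMinor B f) :=
  colMinor_map (starRingEnd ℂ) B f

lemma conj_submatrix_eq_one {B : Matrix (Fin k) (Fin n) ℂ} {f : Fin k → Fin n}
    (h : B.submatrix id f = 1) : (B.map (starRingEnd ℂ)).submatrix id f = 1 := by
  rw [Matrix.submatrix_map, h, Matrix.map_one _ (map_zero _) (map_one _)]

lemma conj_incidenceForm {W : Matrix (Fin n) (Fin k) ℂ} (hW : W.map (starRingEnd ℂ) = W)
    (B : Matrix (Fin k) (Fin n) ℂ) :
    incidenceForm W (B.map (starRingEnd ℂ)) = starRingEnd ℂ (incidenceForm W B) := by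
  have h1 : W.map (algebraMap ℂ ℂ) = W := rfl
  rw [incidenceForm, incidenceForm, h1, RingHom.map_det, RingHom.mapMatrix_apply, Matrix.map_mul,
    hW]

lemma conj_degenerationForm (Q : Matrix (Fin n) (Fin k) ℝ) (α : PluckerIndex k n) (τ : ℝ)
    (B : Matrix (Fin k) (Fin n) ℂ) :
    degenerationForm Q α (τ : ℂ) (B.map (starRingEnd ℂ)) =
      starRingEnd ℂ (degenerationForm Q α (τ : ℂ) B) := by
  rw [degenerationForm, degenerationForm, map_sum]
  refine Finset.sum_congr rfl fun γ _ => ?_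
  split_ifs
  · rw [colMinor_conj, map_mul, map_mul, map_pow, Complex.conj_ofReal]
    congr 2
    exact (Complex.conj_ofReal _).symm
  · rw [map_zero]

lemma IsChartSolution.conj {Q : Matrix (Fin n) (Fin k) ℝ} {W : ℕ → Matrix (Fin n) (Fin k) ℂ}
    (hW : ∀ s, (W s).map (starRingEnd ℂ) = W s) {α β : PluckerIndex k n} {m : ℕ} {τ : ℝ}
    {B : Matrix (Fin k) (Fin n) ℂ} (h : IsChartSolution Q W α β m (τ : ℂ) B) :
    IsChartSolution Q W α β m (τ : ℂ) (B.map (starRingEnd ℂ)) :=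
  ⟨conj_submatrix_eq_one h.1, h.2.map _, fun s hs => by
    rw [conj_incidenceForm (hW s), h.3 s hs, map_zero], by
    rw [conj_degenerationForm, h.4, map_zero]⟩

lemma eq_mul_of_normalize_eq {γ : PluckerIndex k n} {x y : Matrix (Fin k) (Fin n) ℂ}
    (hx : colMinor x γ.1 ≠ 0) (hy : colMinor y γ.1 ≠ 0) (h : normalize γ x = normalize γ y) :
    ∃ P : Matrix (Fin k) (Fin k) ℂ, P.det ≠ 0 ∧ y = P * x := by
  refine ⟨y.submatrix id γ.1 * (x.submatrix id γ.1)⁻¹, ?_, ?_⟩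
  · rw [Matrix.det_mul, Matrix.det_nonsing_inv, Ring.inverse_eq_inv']
    exact mul_ne_zero hy (inv_ne_zero hx)
  · conv_lhs => rw [eq_mul_normalize hy, ← h, normalize]
    rw [Matrix.mul_assoc]

/-- Pairwise disjoint neighbourhoods of the limits of the solutions. -/
lemma exists_separating_nhds {W : ℕ → Matrix (Fin n) (Fin k) ℂ} {α : PluckerIndex k n}
    (hfin : ∀ β, β ⋖ α → (normalizedSolutions W β).Finite) :
    ∃ S : PluckerIndex k n → Matrix (Fin k) (Fin n) ℂ → Set (Matrix (Fin k) (Fin n) ℂ),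
      (∀ β, β ⋖ α → ∀ N ∈ normalizedSolutions W β, S β N ∈ 𝓝 N) ∧
      (∀ β, β ⋖ α → (normalizedSolutions W β).PairwiseDisjoint (S β)) ∧
      ∀ β N, ∀ x ∈ S β N, ∀ β', β' ⋖ α → β' ≠ β → ‖colMinor x β'.1‖ < 1 := by
  have h1 : ∀ β, ∃ T : Matrix (Fin k) (Fin n) ℂ → Set (Matrix (Fin k) (Fin n) ℂ), β ⋖ α →
      (∀ N, N ∈ T N ∧ IsOpen (T N)) ∧ (normalizedSolutions W β).PairwiseDisjoint T := by
    intro β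
    by_cases hβ : β ⋖ α
    · obtain ⟨T, hT⟩ := (hfin β hβ).t2_separation
      exact ⟨T, fun _ => hT⟩
    · exact ⟨fun _ => ∅, fun h => absurd h hβ⟩
  choose T hT using h1
  refine ⟨fun β N => T β N ∩ {x | ∀ β', β' ⋖ α → β' ≠ β → ‖colMinor x β'.1‖ < 1}, ?_, ?_, ?_⟩
  · intro β hβ N hN
    refine inter_mem (((hT β hβ).1 N).2.mem_nhds ((hT β hβ).1 N).1) ?_
    change ∀ᶠ x in 𝓝 N, ∀ β', β' ⋖ α → β' ≠ β → ‖colMinor x β'.1‖ < 1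
    refine eventually_all.2 fun β' => ?_
    by_cases hβ' : β' ⋖ α ∧ β' ≠ β
    · have h0 : ‖colMinor N β'.1‖ < 1 := by
        rw [hN.2.1 β' fun hle => ?_]
        · simp
        · have h2 := PluckerIndex.size_lt (hle.lt_of_ne hβ'.2)
          have h3 := size_of_covBy hβ
          have h4 := size_of_covBy hβ'.1
          omega
      filter_upwards [(continuous_colMinor β'.1).norm.continuousAt.eventually_lt
        continuousAt_const h0] with x hx _ _
      exact hx
    · exact Eventually.of_forall fun x h2 h3 => absurd ⟨h2, h3⟩ hβ'
  · intro β hβ N hN N' hN' hne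
    exact ((hT β hβ).2 hN hN' hne).mono Set.inter_subset_left Set.inter_subset_left
  · exact fun β N x hx => hx.2

/-- For small parameters, the solutions on `Ω_α` correspond to the solutions on the `Ω_β` for
`β` covered by `α`. -/
theorem eventually_hasRealSolutions (hkn : k ≤ n) (Q : Matrix (Fin n) (Fin k) ℝ)
    {W : ℕ → Matrix (Fin n) (Fin k) ℂ} (hW : ∀ s, (W s).map (starRingEnd ℂ) = W s)
    {α : PluckerIndex k n} {m : ℕ} (hm : α.size = m + 1) (hq : rowMinor Q α ≠ 0)
    (hgood : ∀ β, β ⋖ α → HasRealSolutions W β)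
    (hno : ∀ γ : PluckerIndex k n, γ.size < m → HasNoExcessSolutions W γ) :
    ∀ᶠ τ : ℝ in 𝓝 0, τ ≠ 0 →
      (∀ β, β ⋖ α →
        HasNoExcessSolutions (Function.update W m (scaledEquations Q (τ : ℂ))) β) →
      HasRealSolutions (Function.update W m (scaledEquations Q (τ : ℂ))) α := by
  have hβm : ∀ β, β ⋖ α → β.size = m := fun β hβ => by
    have := size_of_covBy hβ
    omega
  have hU : ∀ β (N : Matrix (Fin k) (Fin n) ℂ), ∃ U, β ⋖ α → N ∈ normalizedSolutions W β →
      (∀ V ∈ 𝓝 N, ∀ᶠ τ in 𝓝 (0 : ℂ), ∃ x ∈ V, IsChartSolution Q W α β m τ x) ∧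
      U ∈ 𝓝 N ∧ ∀ᶠ τ in 𝓝 (0 : ℂ), ∀ x ∈ U, IsChartSolution Q W α β m τ x →
        (∀ y ∈ U, IsChartSolution Q W α β m τ y → y = x) ∧
        ∀ M, IsChartSolution Q W α β m (algebraMap ℂ (DualNumber ℂ) τ) (dualMatrix x M) →
          M = 0 := by
    intro β N
    by_cases h : β ⋖ α ∧ N ∈ normalizedSolutions W β
    · obtain ⟨hβ, hN⟩ := h
      have hnd := (hgood β hβ).nondegenerate N hN
      have hN3 := hN.2.2
      rw [hβm β hβ] at hnd hN3
      obtain ⟨h1, U, h2⟩ := local_degeneration hβ hm Q hq W hN.1 hN.2.1 hN3 hnd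
      exact ⟨U, fun _ _ => ⟨h1, h2⟩⟩
    · exact ⟨∅, fun h1 h2 => absurd ⟨h1, h2⟩ h⟩
  choose U hU using hU
  obtain ⟨S, hSn, hSd, hS1⟩ := exists_separating_nhds fun β hβ => (hgood β hβ).finite
  -- Requiring the conjugate to lie in `U β N` too lets uniqueness identify a solution with its
  -- conjugate.
  set V : PluckerIndex k n → Matrix (Fin k) (Fin n) ℂ → Set (Matrix (Fin k) (Fin n) ℂ) :=
    fun β N => (U β N ∩ {x | x.map (starRingEnd ℂ) ∈ U β N}) ∩ S β N with hVdef
  have hV : ∀ β, β ⋖ α → ∀ N ∈ normalizedSolutions W β, V β N ∈ 𝓝 N := by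
    intro β hβ N hN
    refine inter_mem (inter_mem (hU β N hβ hN).2.1 ?_) (hSn β hβ N hN)
    have hc : Continuous fun x : Matrix (Fin k) (Fin n) ℂ => x.map (starRingEnd ℂ) :=
      continuous_id.matrix_map Complex.continuous_conj
    refine hc.continuousAt.preimage_mem_nhds ?_
    rw [(hgood β hβ).real N hN]
    exact (hU β N hβ hN).2.1
  have hex : ∀ᶠ τ in 𝓝 (0 : ℂ), ∀ β, β ⋖ α → ∀ N ∈ normalizedSolutions W β,
      ∃ x ∈ V β N, IsChartSolution Q W α β m τ x := by
    refine eventually_all.2 fun β => ?_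
    by_cases hβ : β ⋖ α
    · have := (eventually_all_finite (hgood β hβ).finite).2 fun N hN =>
        (hU β N hβ hN).1 _ (hV β hβ N hN)
      filter_upwards [this] with τ hτ _
      exact hτ
    · exact Eventually.of_forall fun τ h => absurd h hβ
  have huniq : ∀ᶠ τ in 𝓝 (0 : ℂ), ∀ β, β ⋖ α → ∀ N ∈ normalizedSolutions W β, ∀ x ∈ U β N,
      IsChartSolution Q W α β m τ x →
        (∀ y ∈ U β N, IsChartSolution Q W α β m τ y → y = x) ∧
        ∀ M, IsChartSolution Q W α β m (algebraMap ℂ (DualNumber ℂ) τ) (dualMatrix x M) →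
          M = 0 := by
    refine eventually_all.2 fun β => ?_
    by_cases hβ : β ⋖ α
    · have := (eventually_all_finite (hgood β hβ).finite).2 fun N hN => (hU β N hβ hN).2.2
      filter_upwards [this] with τ hτ _
      exact hτ
    · exact Eventually.of_forall fun τ h => absurd h hβ
  have hcast : Tendsto (fun τ : ℝ => (τ : ℂ)) (𝓝 0) (𝓝 (0 : ℂ)) := by
    have := Complex.continuous_ofReal.tendsto (0 : ℝ)
    rwa [Complex.ofReal_zero] at this
  filter_upwards [hcast.eventually hex, hcast.eventually huniq,
    hcast.eventually (eventually_solutions_near Q hm hq hno hV)]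
    with τ hex huniq hcov hτ0 hno'
  have hτ : (τ : ℂ) ≠ 0 := Complex.ofReal_ne_zero.2 hτ0
  set W' := Function.update W m (scaledEquations Q (τ : ℂ)) with hW'
  have hWm : W' m = scaledEquations Q (τ : ℂ) := Function.update_self ..
  have hWs : ∀ s < m, W' s = W s := fun s hs => Function.update_of_ne hs.ne _ _
  have hforms : ∀ {R : Type} [CommRing R] [Algebra ℂ R] {B : Matrix (Fin k) (Fin n) R},
      InSchubert α B → ((∀ s < α.size, incidenceForm (W' s) B = 0) ↔
        (∀ s < m, incidenceForm (W s) B = 0) ∧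
          degenerationForm Q α (algebraMap ℂ R (τ : ℂ)) B = 0) := by
    intro R _ _ B hB
    rw [degenerationForm_eq_zero_iff Q hτ hB, hm, ← hWm]
    refine ⟨fun h => ⟨fun s hs => hWs s hs ▸ h s (by omega), h m (by omega)⟩,
      fun ⟨h1, h2⟩ s hs => ?_⟩
    rcases (Nat.lt_succ_iff_lt_or_eq.1 hs) with h | rfl
    · rw [hWs s h]
      exact h1 s h
    · exact h2
  have hne : ∀ {β x}, IsChartSolution Q W α β m (τ : ℂ) x → colMinor x α.1 ≠ 0 := by
    intro β x hx
    refine colMinor_ne_zero_of_hasNoExcessSolutions hno' ⟨β, ?_⟩ hx.2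
      ((hforms hx.2).2 ⟨hx.3, hx.4⟩)
    rw [colMinor_eq_one hx.1]
    exact one_ne_zero
  choose! X hXV hXs using hex
  set ι := Σ β : {β : PluckerIndex k n // β ⋖ α}, normalizedSolutions W β.1 with hι
  set g : ι → Matrix (Fin k) (Fin n) ℂ := fun p => normalize α (X p.1.1 p.2.1) with hg
  have hsurj : ∀ B ∈ normalizedSolutions W' α, ∃ p : ι, B = g p ∧ ∃ P : Matrix (Fin k) (Fin k) ℂ,
      P.det ≠ 0 ∧ B = P * X p.1.1 p.2.1 := by
    intro B hB
    obtain ⟨h1, h2⟩ := (hforms hB.2.1).1 hB.2.2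
    obtain ⟨β, hβ, hneβ, N, hN, hNV⟩ := hcov B
      ⟨α, by rw [colMinor_eq_one hB.1]; exact one_ne_zero⟩ hB.2.1 h1 h2
    have hBx := eq_mul_normalize hneβ
    have hS : InSchubert α (normalize β B) := hB.2.1.mul_left _
    have hsol : IsChartSolution Q W α β m (τ : ℂ) (normalize β B) := by
      have h3 := (hforms hS).1 fun s hs => by
        rw [normalize, incidenceForm_mul, hB.2.2 s hs, mul_zero]
      exact ⟨normalize_submatrix hneβ, hS, h3.1, h3.2⟩
    have hX : normalize β B = X β N := (huniq β hβ N hN _ (hXV β hβ N hN).1.1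
      (hXs β hβ N hN)).1 _ hNV.1.1 hsol
    rw [hX] at hBx
    refine ⟨⟨⟨β, hβ⟩, ⟨N, hN⟩⟩, ?_, _, hneβ, hBx⟩
    simp only [hg]
    rw [← normalize_mul (B.submatrix id β.1) hneβ, ← hBx, normalize_eq_self hB.1]
  have hinj : Function.Injective g := by
    rintro ⟨⟨β, hβ⟩, ⟨N, hN⟩⟩ ⟨⟨β', hβ'⟩, ⟨N', hN'⟩⟩ h
    simp only [hg] at h
    have hx := hXs β hβ N hN
    have hx' := hXs β' hβ' N' hN'
    obtain ⟨P, hP, hPx⟩ := eq_mul_of_normalize_eq (hne hx) (hne hx') h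
    -- If `x' = P x` with `β ≠ β'`, then `p_β(x') = det P` has modulus below `1`, while `1 =
    -- p_β'(x') = det P · p_β'(x)` with `|p_β'(x)| < 1`: a contradiction.
    obtain rfl : β = β' := by
      by_contra hb
      have h1 := hS1 β N _ (hXV β hβ N hN).2 β' hβ' (Ne.symm hb)
      have h2 := hS1 β' N' _ (hXV β' hβ' N' hN').2 β hβ hb
      rw [hPx, colMinor_mul, colMinor_eq_one hx.1, mul_one] at h2
      have h3 := congrArg norm (colMinor_eq_one hx'.1)
      rw [hPx, colMinor_mul, norm_mul, norm_one] at h3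
      nlinarith [norm_nonneg P.det, norm_nonneg (colMinor (X β N) β'.1)]
    have hP1 : P = 1 := by
      have h1 : (P * X β N).submatrix id β.1 = P * (X β N).submatrix id β.1 := rfl
      rw [← hPx, hx.1, hx'.1, Matrix.mul_one] at h1
      exact h1.symm
    rw [hP1, Matrix.one_mul] at hPx
    obtain rfl : N = N' := by
      by_contra hb
      refine Set.disjoint_left.1 (hSd β hβ hN hN' hb) (hXV β hβ N hN).2 ?_
      rw [← hPx]
      exact (hXV β hβ' N' hN').2
    rfl
  have hrange : normalizedSolutions W' α = Set.range g := by
    refine Set.Subset.antisymm (fun B hB => ?_) ?_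
    · obtain ⟨p, hp, -⟩ := hsurj B hB
      exact ⟨p, hp.symm⟩
    · rintro _ ⟨⟨⟨β, hβ⟩, ⟨N, hN⟩⟩, rfl⟩
      have hx := hXs β hβ N hN
      exact normalize_mem_normalizedSolutions (hne hx) hx.2 ((hforms hx.2).2 ⟨hx.3, hx.4⟩)
  have hfin : ∀ β : {β : PluckerIndex k n // β ⋖ α}, Finite (normalizedSolutions W β.1) :=
    fun β => (hgood β.1 β.2).finite.to_subtype
  have : Finite ι := by
    rw [hι]
    infer_instance
  refine ⟨hrange ▸ Set.finite_range g, ?_, fun B hB => ?_, fun B hB => ?_⟩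
  · classical
    have := Fintype.ofFinite {β : PluckerIndex k n // β ⋖ α}
    rw [hrange, ← Set.image_univ, Set.ncard_image_of_injective _ hinj, Set.ncard_univ,
      Nat.card_sigma, chainCount_of_not_isBot (not_isBot_of_size_pos hkn (by omega)),
      finsum_eq_sum_of_fintype]
    exact Finset.sum_congr rfl fun β _ => (hgood β.1 β.2).ncard_eq
  · obtain ⟨⟨⟨β, hβ⟩, ⟨N, hN⟩⟩, hp, -⟩ := hsurj B hB
    have hx := hXs β hβ N hN
    have hreal : (X β N).map (starRingEnd ℂ) = X β N :=
      (huniq β hβ N hN _ (hXV β hβ N hN).1.1 hx).1 _ (hXV β hβ N hN).1.2 (hx.conj hW)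
    have h1 : B = ((X β N).submatrix id α.1)⁻¹ * X β N := hp
    have h2 : ((X β N).submatrix id α.1)⁻¹.map (starRingEnd ℂ) =
        ((X β N).submatrix id α.1)⁻¹ := by
      have h3 : ((X β N).submatrix id α.1).map (starRingEnd ℂ) = (X β N).submatrix id α.1 := by
        rw [← Matrix.submatrix_map, hreal]
      have hu : IsUnit ((X β N).submatrix id α.1).det := isUnit_iff_ne_zero.2 (hne hx)
      symm
      refine Matrix.inv_eq_left_inv ?_
      conv_lhs => rw [← h3]
      rw [← Matrix.map_mul, h3, Matrix.nonsing_inv_mul _ hu,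
        Matrix.map_one _ (map_zero _) (map_one _)]
    rw [h1, Matrix.map_mul, h2, hreal]
  · obtain ⟨⟨⟨β, hβ⟩, ⟨N, hN⟩⟩, -, P, hP, hBP⟩ := hsurj B hB
    have hx := hXs β hβ N hN
    rw [hBP]
    refine IsNondegenerate.mul_left (isNondegenerate_of_normalized hx.1 fun M hM h1 h2 => ?_) hP
    have h3 := (hforms h1).1 h2
    exact (huniq β hβ N hN _ (hXV β hβ N hN).1.1 hx).2 M
      ⟨dualMatrix_submatrix_eq_one.2 ⟨hx.1, hM⟩, h1, h3.1, h3.2⟩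

end DegenerationStep

/-! ### The inductive choice of the parameters. -/

section Parameters

variable {k n : ℕ}

/-- Here `α` consists of the first `k` columns, and every later column is forced to vanish. Over the
dual numbers this says that the point `Ω_α` is reduced. -/
lemma eq_of_size_eq_zero {R : Type*} [CommRing R] {α : PluckerIndex k n} (h : α.size = 0)
    {B B' : Matrix (Fin k) (Fin n) R} (hB : B.submatrix id α.1 = 1)
    (hB' : B'.submatrix id α.1 = 1) (hS : InSchubert α B) (hS' : InSchubert α B') : B = B' := by
  ext r j
  rcases lt_or_ge (α.1 r) j with hj | hj
  · rw [hS.entries (Interlaces.refl α) hB r j hj, hS'.entries (Interlaces.refl α) hB' r j hj]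
  · have h1 : ∀ s, (α.1 s : ℕ) = s := fun s => by
      have := (Finset.sum_eq_zero_iff.1 h) s (Finset.mem_univ s)
      have h2 := α.le_apply s
      omega
    have h3 : (j : ℕ) < k := by
      rw [Fin.le_def, h1] at hj
      omega
    have h4 : α.1 ⟨j, h3⟩ = j := Fin.ext (h1 _)
    have h5 : B r (α.1 ⟨j, h3⟩) = B' r (α.1 ⟨j, h3⟩) :=
      congrFun (congrFun (hB.trans hB'.symm) r) ⟨_, h3⟩
    rwa [h4] at h5

lemma hasRealSolutions_of_size_eq_zero (W : ℕ → Matrix (Fin n) (Fin k) ℂ) {α : PluckerIndex k n}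
    (h : α.size = 0) : HasRealSolutions W α := by
  classical
  set B₀ : Matrix (Fin k) (Fin n) ℂ := Matrix.of fun r j => if j = α.1 r then 1 else 0 with hB₀
  have h1 : B₀.submatrix id α.1 = 1 := by
    ext r s
    simp [hB₀, Matrix.one_apply, α.2.injective.eq_iff, eq_comm]
  have h2 : InSchubert α B₀ := inSchubert_of_entries fun r j hj => by
    simp [hB₀, hj.ne']
  have h3 : normalizedSolutions W α = {B₀} := by
    ext B
    refine ⟨fun hB => eq_of_size_eq_zero h hB.1 h1 hB.2.1 h2, ?_⟩
    rintro rfl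
    exact ⟨h1, h2, fun s hs => by omega⟩
  rw [show HasRealSolutions W α ↔ _ from
    ⟨fun h => And.intro h.1 (And.intro h.2 (And.intro h.3 h.4)),
      fun h => ⟨h.1, h.2.1, h.2.2.1, h.2.2.2⟩⟩, h3]
  refine ⟨Set.finite_singleton _, ?_, ?_, ?_⟩
  · rw [Set.ncard_singleton, chainCount_of_isBot (isBot_of_size_eq_zero h)]
  · rintro B rfl
    exact eq_of_size_eq_zero h (conj_submatrix_eq_one h1) h1 (h2.map _) h2
  · rintro B rfl
    refine isNondegenerate_of_normalized h1 fun M hM hS _ => ?_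
    have h4 := eq_of_size_eq_zero h (dualMatrix_submatrix_eq_one.2 ⟨h1, hM⟩)
      (dualMatrix_submatrix_eq_one.2 ⟨h1, rfl⟩) hS (by rw [dualMatrix_zero]; exact h2.map _)
    ext r j
    have h5 := congrArg TrivSqZeroExt.snd (congrFun (congrFun h4 r) j)
    rwa [snd_dualMatrix, snd_dualMatrix] at h5

lemma conj_scaledEquations (Q : Matrix (Fin n) (Fin k) ℝ) (t : ℝ) :
    (scaledEquations Q (t : ℂ)).map (starRingEnd ℂ) = scaledEquations Q (t : ℂ) := by
  ext j r
  simp [scaledEquations]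

/-- The two statements are proved together: nonexistence of excess solutions lags one size behind,
since it needs finiteness of the solutions and one further parameter. -/
theorem exists_parameters (hkn : k ≤ n) (Q : Matrix (Fin n) (Fin k) ℝ)
    (hq : ∀ γ : PluckerIndex k n, rowMinor Q γ ≠ 0) (m : ℕ) :
    ∃ t : ℕ → ℝ, (∀ i, t i ≠ 0) ∧
      (∀ α : PluckerIndex k n, α.size ≤ m →
        HasRealSolutions (fun s => scaledEquations Q (t s : ℂ)) α) ∧
      ∀ α : PluckerIndex k n, α.size < m →
        HasNoExcessSolutions (fun s => scaledEquations Q (t s : ℂ)) α := by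
  induction m with
  | zero =>
    exact ⟨1, fun _ => one_ne_zero, fun α hα => hasRealSolutions_of_size_eq_zero _ (by omega),
      fun α hα => absurd hα (Nat.not_lt_zero _)⟩
  | succ m ih =>
    obtain ⟨t, ht, hreal, hno⟩ := ih
    set W : ℕ → Matrix (Fin n) (Fin k) ℂ := fun s => scaledEquations Q (t s : ℂ) with hW
    have hcast : Tendsto (fun τ : ℝ => (τ : ℂ)) (𝓝 0) (𝓝 (0 : ℂ)) := by
      have := Complex.continuous_ofReal.tendsto (0 : ℝ)
      rwa [Complex.ofReal_zero] at this
    have h1 : ∀ᶠ τ : ℝ in 𝓝 0, ∀ β : PluckerIndex k n, β.size = m → τ ≠ 0 →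
        HasNoExcessSolutions (Function.update W m (scaledEquations Q (τ : ℂ))) β := by
      refine eventually_all.2 fun β => ?_
      by_cases hβ : β.size = m
      · subst hβ
        filter_upwards [hcast.eventually (eventually_hasNoExcessSolutions Q (hq β)
          (hreal β le_rfl).finite fun γ hγ => hno γ (PluckerIndex.size_lt hγ.lt))] with τ hτ _ h0
        exact hτ (Complex.ofReal_ne_zero.2 h0)
      · exact Eventually.of_forall fun τ h => absurd h hβ
    have h2 : ∀ᶠ τ : ℝ in 𝓝 0, ∀ α : PluckerIndex k n, α.size = m + 1 → τ ≠ 0 →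
        (∀ β, β ⋖ α →
          HasNoExcessSolutions (Function.update W m (scaledEquations Q (τ : ℂ))) β) →
        HasRealSolutions (Function.update W m (scaledEquations Q (τ : ℂ))) α := by
      refine eventually_all.2 fun α => ?_
      by_cases hα : α.size = m + 1
      · filter_upwards [eventually_hasRealSolutions hkn Q (fun s => conj_scaledEquations Q (t s))
          hα (hq α) (fun β hβ => hreal β (by have := size_of_covBy hβ; omega)) hno] with τ hτ _
        exact hτ
      · exact Eventually.of_forall fun τ h => absurd h hα
    -- There are finitely many indices, so one small nonzero `τ` serves them all.
    obtain ⟨τ, ⟨hτ1, hτ2⟩, hτ0⟩ := (((h1.and h2).filter_mono nhdsWithin_le_nhds).and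
      (self_mem_nhdsWithin (s := {(0 : ℝ)}ᶜ))).exists
    have hτ0 : τ ≠ 0 := hτ0
    have hW' : (fun s => scaledEquations Q (Function.update t m τ s : ℂ)) =
        Function.update W m (scaledEquations Q (τ : ℂ)) := by
      funext s
      rcases eq_or_ne s m with rfl | hs
      · rw [Function.update_self, Function.update_self]
      · rw [Function.update_of_ne hs, Function.update_of_ne hs]
    have hWs : ∀ s < m, W s = Function.update W m (scaledEquations Q (τ : ℂ)) s :=
      fun s hs => (Function.update_of_ne hs.ne _ _).symm
    refine ⟨Function.update t m τ, fun i => ?_, ?_⟩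
    · rcases eq_or_ne i m with rfl | hi
      · rwa [Function.update_self]
      · rw [Function.update_of_ne hi]
        exact ht i
    rw [hW']
    constructor
    · intro α hα
      rcases hα.lt_or_eq with hα | hα
      · exact (hreal α (by omega)).congr fun s hs => hWs s (by omega)
      · exact hτ2 α hα hτ0 fun β hβ => hτ1 β (by have := size_of_covBy hβ; omega) hτ0
    · intro α hα
      rcases (Nat.lt_succ_iff_lt_or_eq.1 hα) with hα | hα
      · exact (hno α hα).congr fun s hs => hWs s (by omega)
      · exact hτ1 α hα hτ0

end Parameters

/-! ### From row spaces to matrices and their minors. -/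

section RowSpaces

variable {F : Type*} [Field F] {m k n : ℕ}

lemma mem_rowSpace {A : Matrix (Fin m) (Fin n) F} {v : Fin n → F} :
    v ∈ rowSpace A ↔ ∃ u, Matrix.vecMul u A = v := by
  rw [rowSpace, Submodule.mem_span_range_iff_exists_fun]
  simp only [Matrix.vecMul_eq_sum]
  rfl

lemma vecMul_eq_zero_iff_of_finrank {A : Matrix (Fin m) (Fin n) F}
    (hA : Module.finrank F (rowSpace A) = m) {u : Fin m → F} : Matrix.vecMul u A = 0 ↔ u = 0 := by
  have h1 : LinearIndependent F A.row := by
    rw [linearIndependent_iff_card_eq_finrank_span, Fintype.card_fin]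
    exact hA.symm
  rw [← Matrix.vecMul_injective_iff] at h1
  refine ⟨fun h => h1 (h.trans (Matrix.zero_vecMul A).symm), ?_⟩
  rintro rfl
  exact Matrix.zero_vecMul A

lemma finrank_rowSpace {A : Matrix (Fin m) (Fin n) F}
    (h : ∀ u, Matrix.vecMul u A = 0 → u = 0) : Module.finrank F (rowSpace A) = m := by
  have h1 : LinearIndependent F A.row := by
    rw [← Matrix.vecMul_injective_iff]
    intro u v huv
    rw [← sub_eq_zero]
    refine h _ ?_
    rw [Matrix.sub_vecMul, sub_eq_zero]
    exact huv
  have h2 := finrank_span_eq_card h1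
  rwa [Fintype.card_fin] at h2

lemma finrank_rowSpace_of_colMinor {B : Matrix (Fin k) (Fin n) F} {γ : PluckerIndex k n}
    (h : colMinor B γ.1 ≠ 0) : Module.finrank F (rowSpace B) = k := by
  refine finrank_rowSpace fun u hu => ?_
  by_contra hne
  refine h (Matrix.exists_vecMul_eq_zero_iff.1 ⟨u, hne, ?_⟩)
  funext i
  exact congrFun hu (γ.1 i)

/-- A matrix of full row rank has a right inverse; expand the determinant of the product by
Cauchy–Binet. -/
lemma exists_colMinor_ne_zero {B : Matrix (Fin k) (Fin n) F}
    (h : Module.finrank F (rowSpace B) = k) : ∃ γ : PluckerIndex k n, colMinor B γ.1 ≠ 0 := by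
  have hinj : LinearMap.ker B.vecMulLinear = ⊥ := by
    rw [LinearMap.ker_eq_bot']
    exact fun u hu => (vecMul_eq_zero_iff_of_finrank h).1 hu
  obtain ⟨g, hg⟩ := LinearMap.exists_leftInverse_of_injective _ hinj
  have h1 : B * (LinearMap.toMatrix' g).transpose = 1 := by
    ext i j
    have h2 : Matrix.vecMul (Pi.single i 1) (B * (LinearMap.toMatrix' g).transpose) = Pi.single i 1 := by
      rw [← Matrix.vecMul_vecMul, Matrix.vecMul_transpose, LinearMap.toMatrix'_mulVec]
      exact LinearMap.congr_fun hg (Pi.single i 1)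
    rw [Matrix.single_one_vecMul] at h2
    rw [Matrix.one_eq_pi_single]
    exact congrFun h2 j
  by_contra! h0
  have h3 := det_mul_eq_sum_colMinor B (LinearMap.toMatrix' g).transpose
  rw [h1, Matrix.det_one, Finset.sum_eq_zero fun γ _ => by rw [h0 γ, zero_mul]] at h3
  exact one_ne_zero h3

lemma rowSpace_mul_le (P : Matrix (Fin k) (Fin m) F) (B : Matrix (Fin m) (Fin n) F) :
    rowSpace (P * B) ≤ rowSpace B := by
  intro v hv
  obtain ⟨u, rfl⟩ := mem_rowSpace.1 hv
  exact mem_rowSpace.2 ⟨Matrix.vecMul u P, Matrix.vecMul_vecMul ..⟩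

lemma rowSpace_mul {P : Matrix (Fin k) (Fin k) F} (hP : P.det ≠ 0) (B : Matrix (Fin k) (Fin n) F) :
    rowSpace (P * B) = rowSpace B := by
  refine le_antisymm (rowSpace_mul_le P B) ?_
  have := rowSpace_mul_le P⁻¹ (P * B)
  rwa [← Matrix.mul_assoc, Matrix.nonsing_inv_mul _ (isUnit_iff_ne_zero.2 hP),
    Matrix.one_mul] at this

lemma rowSpace_normalize {γ : PluckerIndex k n} {B : Matrix (Fin k) (Fin n) F}
    (h : colMinor B γ.1 ≠ 0) : rowSpace (normalize γ B) = rowSpace B := by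
  conv_rhs => rw [eq_mul_normalize h]
  exact (rowSpace_mul h _).symm

lemma exists_eq_mul_of_rowSpace_le {A : Matrix (Fin k) (Fin n) F} {B : Matrix (Fin m) (Fin n) F}
    (h : rowSpace A ≤ rowSpace B) : ∃ P : Matrix (Fin k) (Fin m) F, A = P * B := by
  have h1 : ∀ i, ∃ u, Matrix.vecMul u B = A i := fun i =>
    mem_rowSpace.1 (h (Submodule.subset_span ⟨i, rfl⟩))
  choose u hu using h1
  refine ⟨Matrix.of u, ?_⟩
  ext i j
  rw [← hu i]
  rfl

lemma exists_rowSpace_eq {K : Submodule F (Fin n → F)} (hK : Module.finrank F K = k) :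
    ∃ B : Matrix (Fin k) (Fin n) F, rowSpace B = K := by
  let b := Module.finBasisOfFinrankEq F K hK
  refine ⟨Matrix.of fun i => (b i : Fin n → F), ?_⟩
  have h1 : Set.range (Matrix.of fun i => (b i : Fin n → F)).row =
      K.subtype '' Set.range b := by
    rw [← Set.range_comp]
    rfl
  rw [rowSpace, h1, Submodule.span_image, b.span_eq, Submodule.map_top, Submodule.range_subtype]

lemma mem_schubertVariety_iff {B : Matrix (Fin k) (Fin n) F} (α : PluckerIndex k n)
    (h : Module.finrank F (rowSpace B) = k) :
    rowSpace B ∈ schubertVariety F α ↔ InSchubert α B := by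
  refine ⟨fun hK γ hγ => hK.2 γ hγ B rfl, fun hS => ⟨h, fun γ hγ A hA => ?_⟩⟩
  obtain ⟨P, rfl⟩ := exists_eq_mul_of_rowSpace_le hA.le
  exact (colMinor_mul P B γ.1).trans (by rw [hS γ hγ, mul_zero])

lemma mem_specialSchubert_iff {B : Matrix (Fin k) (Fin n) F} {W : Matrix (Fin n) (Fin k) F}
    {M : Submodule F (Fin n → F)} (hM : ∀ v, v ∈ M ↔ Matrix.vecMul v W = 0)
    (h : Module.finrank F (rowSpace B) = k) :
    rowSpace B ∈ specialSchubert k M ↔ (B * W).det = 0 := by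
  rw [← Matrix.exists_vecMul_eq_zero_iff]
  constructor
  · rintro ⟨-, hne⟩
    obtain ⟨v, hv, hv0⟩ := (Submodule.ne_bot_iff _).1 hne
    obtain ⟨u, rfl⟩ := mem_rowSpace.1 hv.1
    refine ⟨u, ?_, ?_⟩
    · rintro rfl
      exact hv0 (Matrix.zero_vecMul B)
    · rw [← Matrix.vecMul_vecMul]
      exact (hM _).1 hv.2
  · rintro ⟨u, hu, huW⟩
    refine ⟨h, (Submodule.ne_bot_iff _).2 ⟨Matrix.vecMul u B, ⟨mem_rowSpace.2 ⟨u, rfl⟩, ?_⟩, ?_⟩⟩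
    · refine (hM _).2 ?_
      rwa [Matrix.vecMul_vecMul]
    · exact fun h0 => hu ((vecMul_eq_zero_iff_of_finrank h).1 h0)

end RowSpaces

/-! ### Equations of `L`, its scalings and its complexification. -/

section RealEquations

variable {k n : ℕ}

lemma exists_equations {F : Type*} [Field F] (hkn : k ≤ n) {L : Submodule F (Fin n → F)}
    (hL : Module.finrank F L = n - k) :
    ∃ Q : Matrix (Fin n) (Fin k) F, ∀ v, v ∈ L ↔ Matrix.vecMul v Q = 0 := by
  have h1 : Module.finrank F ((Fin n → F) ⧸ L) = k := by
    have := L.finrank_quotient_add_finrank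
    rw [hL, Module.finrank_fin_fun] at this
    omega
  have e : ((Fin n → F) ⧸ L) ≃ₗ[F] (Fin k → F) :=
    LinearEquiv.ofFinrankEq _ _ (by rw [h1, Module.finrank_fin_fun])
  refine ⟨(LinearMap.toMatrix' (e.toLinearMap ∘ₗ L.mkQ)).transpose, fun v => ?_⟩
  rw [Matrix.vecMul_transpose, LinearMap.toMatrix'_mulVec]
  simp

/-- If no Plücker coordinate of `L` vanishes, then neither do the complementary maximal minors of
its equations. -/
lemma rowMinor_ne_zero {L : Submodule ℝ (Fin n → ℝ)}
    (hPlucker : ∀ β : PluckerIndex (n - k) n, ¬ PluckerVanishes L β)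
    {Q : Matrix (Fin n) (Fin k) ℝ} (hQ : ∀ v, v ∈ L ↔ Matrix.vecMul v Q = 0)
    (γ : PluckerIndex k n) : rowMinor Q γ ≠ 0 := by
  classical
  rw [rowMinor, Complex.ofReal_ne_zero]
  intro h0
  -- A vanishing minor gives a nonzero vector of `L` supported on the columns `γ`. It vanishes on
  -- the complementary columns `δ`, where the Plücker coordinate of `L` is nonzero, so it must be
  -- zero.
  obtain ⟨w, hw, hw0⟩ := Matrix.exists_vecMul_eq_zero_iff.2 h0
  set v : Fin n → ℝ := Function.extend γ.1 w 0 with hv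
  have hvγ : ∀ i, v (γ.1 i) = w i := fun i => γ.2.injective.extend_apply _ _ i
  have hv0 : ∀ j, j ∉ Set.range γ.1 → v j = 0 := fun j hj =>
    Function.extend_apply' _ _ _ fun ⟨i, hi⟩ => hj ⟨i, hi⟩
  have hvL : v ∈ L := by
    rw [hQ]
    rw [← hw0]
    funext r
    simp only [Matrix.vecMul, dotProduct, Matrix.submatrix_apply, id]
    symm
    refine Finset.sum_of_injOn γ.1 γ.2.injective.injOn (by simp) ?_ ?_
    · intro j _ hj
      rw [hv0 j (by simpa using hj), zero_mul]
    · intro i _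
      rw [hvγ]
  have hcard : (Finset.univ.image γ.1)ᶜ.card = n - k := by
    rw [Finset.card_compl, Finset.card_image_of_injective _ γ.2.injective]
    simp
  set δ : PluckerIndex (n - k) n :=
    ⟨(Finset.univ.image γ.1)ᶜ.orderEmbOfFin hcard, OrderEmbedding.strictMono _⟩ with hδ
  have hδ' : ∀ i, δ.1 i ∉ Set.range γ.1 := fun i => by
    intro hi
    refine Finset.mem_compl.1 (Finset.orderEmbOfFin_mem _ hcard i) ?_
    simpa using hi
  have hP := hPlucker δ
  simp only [PluckerVanishes, not_forall] at hP
  obtain ⟨A, rfl, hA⟩ := hP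
  obtain ⟨u, hu⟩ := mem_rowSpace.1 hvL
  have hu0 : u = 0 := by
    by_contra hne
    refine hA (Matrix.exists_vecMul_eq_zero_iff.1 ⟨u, hne, ?_⟩)
    funext i
    exact (congrFun hu (δ.1 i)).trans (hv0 _ (hδ' i))
  refine hw (funext fun i => ?_)
  rw [← hvγ, ← hu, hu0, Matrix.zero_vecMul]
  rfl

/-- The equations are real, so they hold for a complex vector exactly when they hold for its real
and imaginary parts. -/
lemma mem_complexify_iff {U : Submodule ℝ (Fin n → ℝ)} {Q : Matrix (Fin n) (Fin k) ℝ}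
    (hQ : ∀ v, v ∈ U ↔ Matrix.vecMul v Q = 0) (z : Fin n → ℂ) :
    z ∈ complexify U ↔ Matrix.vecMul z (Q.map Complex.ofRealHom) = 0 := by
  have hre : ∀ (v : Fin n → ℝ), Matrix.vecMul (fun j => (v j : ℂ)) (Q.map Complex.ofRealHom) =
      fun r => ((Matrix.vecMul v Q r : ℝ) : ℂ) := by
    intro v
    funext r
    simp [Matrix.vecMul, dotProduct]
  constructor
  · intro hz
    have hle : complexify U ≤ LinearMap.ker (Q.map Complex.ofRealHom).vecMulLinear := by
      refine Submodule.span_le.2 ?_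
      rintro _ ⟨v, hv, rfl⟩
      change Matrix.vecMul (fun j => (v j : ℂ)) (Q.map Complex.ofRealHom) = 0
      rw [hre, (hQ v).1 hv]
      funext r
      simp
    exact hle hz
  · intro hz
    have hz' : z = (fun j => (((z j).re : ℝ) : ℂ)) +
        Complex.I • (fun j => (((z j).im : ℝ) : ℂ)) := by
      funext j
      simp only [Pi.add_apply, Pi.smul_apply, smul_eq_mul]
      rw [mul_comm, Complex.re_add_im]
    have h1 : ∀ r, ((Matrix.vecMul (fun j => (z j).re) Q r : ℝ) : ℂ) +
        Complex.I * ((Matrix.vecMul (fun j => (z j).im) Q r : ℝ) : ℂ) = 0 := by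
      intro r
      have := congrFun hz r
      rw [hz', Matrix.add_vecMul, Matrix.smul_vecMul, hre, hre] at this
      simpa using this
    have h2 : (fun j => (z j).re) ∈ U := by
      rw [hQ]
      funext r
      simpa using congrArg Complex.re (h1 r)
    have h3 : (fun j => (z j).im) ∈ U := by
      rw [hQ]
      funext r
      simpa using congrArg Complex.im (h1 r)
    rw [hz']
    exact Submodule.add_mem _ (Submodule.subset_span ⟨_, h2, rfl⟩)
      (Submodule.smul_mem _ _ (Submodule.subset_span ⟨_, h3, rfl⟩))

lemma mem_complexify_scaling_iff {L : Submodule ℝ (Fin n → ℝ)} {Q : Matrix (Fin n) (Fin k) ℝ}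
    (hQ : ∀ v, v ∈ L ↔ Matrix.vecMul v Q = 0) {t : ℝ} (ht : t ≠ 0) (z : Fin n → ℂ) :
    z ∈ complexify (L.map (weightScaling n t)) ↔
      Matrix.vecMul z (scaledEquations Q (t : ℂ)) = 0 := by
  have h1 : scaledEquations Q (t : ℂ) =
      (Matrix.of fun (j : Fin n) (r : Fin k) => t⁻¹ ^ ((j : ℕ) + 1) * Q j r).map
        Complex.ofRealHom := by
    ext j r
    simp [scaledEquations]
  rw [h1]
  refine mem_complexify_iff (fun x => ?_) z
  have h2 : Matrix.vecMul x (Matrix.of fun (j : Fin n) (r : Fin k) => t⁻¹ ^ ((j : ℕ) + 1) * Q j r) =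
      Matrix.vecMul (fun j : Fin n => t⁻¹ ^ ((j : ℕ) + 1) * x j) Q := by
    funext r
    simp only [Matrix.vecMul, dotProduct, Matrix.of_apply]
    exact Finset.sum_congr rfl fun j _ => by ring
  rw [h2, ← hQ, Submodule.mem_map]
  constructor
  · rintro ⟨y, hy, rfl⟩
    convert hy using 1
    funext j
    simp only [weightScaling, LinearMap.pi_apply, LinearMap.smul_apply, LinearMap.proj_apply,
      smul_eq_mul]
    rw [← mul_assoc, ← mul_pow, inv_mul_cancel₀ ht, one_pow, one_mul]
  · intro hy
    refine ⟨_, hy, ?_⟩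
    funext j
    simp only [weightScaling, LinearMap.pi_apply, LinearMap.smul_apply, LinearMap.proj_apply,
      smul_eq_mul]
    rw [← mul_assoc, ← mul_pow, mul_inv_cancel₀ ht, one_pow, one_mul]

lemma isRealPlane_of_conj {B : Matrix (Fin k) (Fin n) ℂ} (h : B.map (starRingEnd ℂ) = B) :
    IsRealPlane (rowSpace B) := by
  have h1 : ∀ i j, ((B i j).re : ℂ) = B i j := fun i j =>
    Complex.conj_eq_iff_re.1 (congrFun (congrFun h i) j)
  set B' : Matrix (Fin k) (Fin n) ℝ := Matrix.of fun i j => (B i j).re with hB'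
  refine ⟨rowSpace B', le_antisymm (Submodule.span_le.2 ?_) (Submodule.span_le.2 ?_)⟩
  · rintro _ ⟨v, hv, rfl⟩
    obtain ⟨u, rfl⟩ := mem_rowSpace.1 hv
    refine mem_rowSpace.2 ⟨fun i => (u i : ℂ), ?_⟩
    funext j
    simp [Matrix.vecMul, dotProduct, hB', h1]
  · rintro _ ⟨i, rfl⟩
    exact Submodule.subset_span ⟨B' i, Submodule.subset_span ⟨i, rfl⟩, funext fun j => h1 i j⟩

end RealEquations

/-! ### From nondegeneracy to transversality in affine charts. -/

section Transversality

variable {k n : ℕ}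

/-- After normalization in the columns `α`, these minors are the entries beyond the staircase, up to
a unit. So on `p_α ≠ 0` the variety is cut out by as many equations as its codimension. -/
lemma inSchubert_iff_of_isUnit {R : Type*} [CommRing R] {α : PluckerIndex k n}
    {B : Matrix (Fin k) (Fin n) R} (hu : IsUnit (colMinor B α.1)) :
    InSchubert α B ↔ ∀ p : {p : Fin k × Fin n // p.2 ∉ Set.range α.1 ∧ α.1 p.1 < p.2},
      colMinor B (Function.update α.1 p.1.1 p.1.2) = 0 := by
  set N := (B.submatrix id α.1)⁻¹ * B with hN
  have hN1 : N.submatrix id α.1 = 1 := Matrix.nonsing_inv_mul (B.submatrix id α.1) hu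
  have hB : B = B.submatrix id α.1 * N := by
    rw [hN, ← Matrix.mul_assoc, Matrix.mul_nonsing_inv _ hu, Matrix.one_mul]
  have h1 : ∀ r j, colMinor B (Function.update α.1 r j) = colMinor B α.1 * N r j := by
    intro r j
    conv_lhs => rw [hB, colMinor_mul, colMinor_update hN1]
    rfl
  constructor
  · intro h p
    have hS : InSchubert α N := h.mul_left _
    rw [h1, hS.entries (Interlaces.refl α) hN1 _ _ p.2.2, mul_zero]
  · intro h
    rw [hB]
    refine InSchubert.mul_left (inSchubert_of_entries fun r j hj => ?_) _
    by_cases hjα : j ∈ Set.range α.1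
    · obtain ⟨s, rfl⟩ := hjα
      have hne : r ≠ s := by
        rintro rfl
        exact lt_irrefl _ hj
      have := congrFun (congrFun hN1 r) s
      rwa [Matrix.one_apply_ne hne] at this
    · have := h ⟨(r, j), hjα, hj⟩
      rw [h1] at this
      exact (hu.mul_right_eq_zero).1 this

/-- The matrix `A + X C` with indeterminate entries of `X`. -/
noncomputable def chartMatrix (A : Matrix (Fin k) (Fin n) ℂ) (C : Matrix (Fin (n - k)) (Fin n) ℂ) :
    Matrix (Fin k) (Fin n) (MvPolynomial (Fin k × Fin (n - k)) ℂ) :=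
  A.map MvPolynomial.C + Matrix.of (fun i j => MvPolynomial.X (i, j)) * C.map MvPolynomial.C

lemma chartMatrix_apply (A : Matrix (Fin k) (Fin n) ℂ) (C : Matrix (Fin (n - k)) (Fin n) ℂ)
    (i : Fin k) (j : Fin n) : chartMatrix A C i j =
      MvPolynomial.C (A i j) + ∑ l, MvPolynomial.X (i, l) * MvPolynomial.C (C l j) :=
  rfl

lemma chartMatrix_map_eval (A : Matrix (Fin k) (Fin n) ℂ) (C : Matrix (Fin (n - k)) (Fin n) ℂ)
    (x : Fin k × Fin (n - k) → ℂ) :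
    (chartMatrix A C).map (MvPolynomial.eval x) = A + Matrix.of (fun i j => x (i, j)) * C := by
  ext i j
  simp [chartMatrix_apply, Matrix.mul_apply]

lemma eval_incidenceForm {σ : Type*} (W : Matrix (Fin n) (Fin k) ℂ)
    (B : Matrix (Fin k) (Fin n) (MvPolynomial σ ℂ)) (x : σ → ℂ) :
    MvPolynomial.eval x (incidenceForm W B) = incidenceForm W (B.map (MvPolynomial.eval x)) := by
  rw [← MvPolynomial.coe_aeval_eq_eval]
  exact (incidenceForm_map (MvPolynomial.aeval x) W B).symm

lemma eval_colMinor {σ : Type*} (B : Matrix (Fin k) (Fin n) (MvPolynomial σ ℂ))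
    (f : Fin k → Fin n) (x : σ → ℂ) :
    MvPolynomial.eval x (colMinor B f) = colMinor (B.map (MvPolynomial.eval x)) f :=
  (colMinor_map (MvPolynomial.eval x) B f).symm

lemma chartMatrix_map_dual (A : Matrix (Fin k) (Fin n) ℂ) (C : Matrix (Fin (n - k)) (Fin n) ℂ)
    (v : Fin k × Fin (n - k) → ℂ) :
    (chartMatrix A C).map (MvPolynomial.aeval (R := ℂ) fun s =>
      (TrivSqZeroExt.inl ((0 : Fin k × Fin (n - k) → ℂ) s) + TrivSqZeroExt.inr (v s) :
        DualNumber ℂ)) = dualMatrix A (Matrix.of (fun i j => v (i, j)) * C) := by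
  have h0 : ∀ c : ℂ, algebraMap ℂ (DualNumber ℂ) c = TrivSqZeroExt.inl c := fun _ => rfl
  ext i j
  · rw [fst_dualMatrix]
    simp [chartMatrix_apply, TrivSqZeroExt.fst_sum, h0]
  · rw [snd_dualMatrix]
    simp [chartMatrix_apply, Matrix.mul_apply, TrivSqZeroExt.snd_sum, h0, mul_comm]

/-- A square matrix with trivial kernel is invertible. -/
lemma linearIndependent_of_common_kernel {q σ : Type*} [Fintype q] [Fintype σ]
    (hcard : Fintype.card q = Fintype.card σ) (w : q → σ → ℂ)
    (h : ∀ v : σ → ℂ, (∀ i, ∑ s, w i s * v s = 0) → v = 0) : LinearIndependent ℂ w := by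
  classical
  let e : q ≃ σ := Fintype.equivOfCardEq hcard
  have h1 : LinearIndependent ℂ (Matrix.of fun s => w (e.symm s)).row := by
    rw [Matrix.linearIndependent_rows_iff_isUnit, ← Matrix.mulVec_injective_iff_isUnit]
    intro u v huv
    rw [← sub_eq_zero]
    refine h _ fun i => ?_
    have h2 := congrFun huv (e i)
    simp only [Matrix.mulVec, dotProduct, Matrix.of_apply, Equiv.symm_apply_apply] at h2
    simp only [Pi.sub_apply, mul_sub, Finset.sum_sub_distrib, h2, sub_self]
  have h2 := h1.comp e e.injective
  convert h2 using 1
  funext i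
  change w i = w (e.symm (e i))
  rw [e.symm_apply_apply]

lemma finrank_rowSpace_chart {A : Matrix (Fin k) (Fin n) ℂ} {C : Matrix (Fin (n - k)) (Fin n) ℂ}
    (hA : Module.finrank ℂ (rowSpace A) = k) (hAC : IsCompl (rowSpace A) (rowSpace C))
    (X : Matrix (Fin k) (Fin (n - k)) ℂ) : Module.finrank ℂ (rowSpace (A + X * C)) = k := by
  refine finrank_rowSpace fun u hu => ?_
  rw [Matrix.vecMul_add, ← Matrix.vecMul_vecMul, add_eq_zero_iff_eq_neg] at hu
  have h1 : Matrix.vecMul u A ∈ rowSpace A ⊓ rowSpace C := by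
    refine ⟨mem_rowSpace.2 ⟨u, rfl⟩, ?_⟩
    rw [hu]
    exact Submodule.neg_mem _ (mem_rowSpace.2 ⟨_, rfl⟩)
  rw [hAC.inf_eq_bot, Submodule.mem_bot] at h1
  exact (vecMul_eq_zero_iff_of_finrank hA).1 h1

theorem transverseAt_of_isNondegenerate {N : ℕ} {α : PluckerIndex k n} (hα : α.size ≤ N)
    {Z : Fin N → Submodule ℂ (Fin n → ℂ)} {W : ℕ → Matrix (Fin n) (Fin k) ℂ}
    (hZ : ∀ (i : Fin N) z, z ∈ Z i ↔ Matrix.vecMul z (W i) = 0)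
    {Y : Option {i : Fin N // (i : ℕ) < α.size} → Set (Submodule ℂ (Fin n → ℂ))}
    (hY0 : Y none = schubertVariety ℂ α) (hY : ∀ i, Y (some i) = specialSchubert k (Z i.1))
    {B : Matrix (Fin k) (Fin n) ℂ} (hB : B ∈ normalizedSolutions W α)
    (hnd : IsNondegenerate α W α.size B) : TransverseAt k Y (rowSpace B) := by
  classical
  intro A C hA hAC
  have hB1 : colMinor B α.1 ≠ 0 := by
    rw [colMinor_eq_one hB.1]
    exact one_ne_zero
  have hAk : Module.finrank ℂ (rowSpace A) = k := by
    rw [hA]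
    exact finrank_rowSpace_of_colMinor hB1
  rw [← hA] at hAC
  obtain ⟨P, rfl⟩ := exists_eq_mul_of_rowSpace_le hA.le
  have hP : P.det ≠ 0 := by
    obtain ⟨γ, hγ⟩ := exists_colMinor_ne_zero hAk
    rw [colMinor_mul] at hγ
    exact left_ne_zero_of_mul hγ
  set A := P * B with hAdef
  have hAα : colMinor A α.1 ≠ 0 := by
    rw [colMinor_mul]
    exact mul_ne_zero hP hB1
  have hndA : IsNondegenerate α W α.size A := hnd.mul_left hP
  have hAS : InSchubert α A := hB.2.1.mul_left P
  have hAW : ∀ s < α.size, incidenceForm (W s) A = 0 := fun s hs => by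
    rw [incidenceForm_mul, hB.2.2 s hs, mul_zero]
  have heval0 : (chartMatrix A C).map (MvPolynomial.eval 0) = A := by
    rw [chartMatrix_map_eval]
    have : (Matrix.of fun i j => (0 : Fin k × Fin (n - k) → ℂ) (i, j)) = 0 := rfl
    rw [this, Matrix.zero_mul, add_zero]
  set E := {p : Fin k × Fin n // p.2 ∉ Set.range α.1 ∧ α.1 p.1 < p.2} with hE
  let e : Fin (Fintype.card E) ≃ E := (Fintype.equivFin E).symm
  let c : Option {i : Fin N // (i : ℕ) < α.size} → ℕ
    | none => Fintype.card E
    | some _ => 1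
  let f : (i : Option {i : Fin N // (i : ℕ) < α.size}) → Fin (c i) →
      MvPolynomial (Fin k × Fin (n - k)) ℂ
    | none => fun q => colMinor (chartMatrix A C) (Function.update α.1 (e q).1.1 (e q).1.2)
    | some i => fun _ => incidenceForm (W i.1) (chartMatrix A C)
  have hf0 : ∀ i q, MvPolynomial.eval 0 (f i q) = 0 := by
    rintro (_ | i) q
    · simp only [f]
      rw [eval_colMinor, heval0]
      exact (inSchubert_iff_of_isUnit (isUnit_iff_ne_zero.2 hAα)).1 hAS (e q)
    · simp only [f]
      rw [eval_incidenceForm, heval0]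
      exact hAW _ i.2
  refine ⟨c, f, ?_, ?_⟩
  · rintro (_ | i)
    · refine ⟨colMinor (chartMatrix A C) α.1, ?_, fun x hx => ?_⟩
      · rwa [eval_colMinor, heval0]
      · rw [eval_colMinor] at hx
        have h1 : ∀ q, MvPolynomial.eval x (f none q) = colMinor
            ((chartMatrix A C).map (MvPolynomial.eval x))
            (Function.update α.1 (e q).1.1 (e q).1.2) := fun q => eval_colMinor _ _ _
        simp only [h1, chartTrace, Set.mem_ofPred_eq, hY0]
        rw [← chartMatrix_map_eval, mem_schubertVariety_iff α (finrank_rowSpace_of_colMinor hx),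
          inSchubert_iff_of_isUnit (isUnit_iff_ne_zero.2 hx)]
        exact e.forall_congr_right.symm
    -- The determinantal equation is valid on the whole chart, so no localization is needed.
    · refine ⟨1, by simp, fun x _ => ?_⟩
      have h1 : ∀ q, MvPolynomial.eval x (f (some i) q) = incidenceForm (W i.1)
          ((chartMatrix A C).map (MvPolynomial.eval x)) := fun q => eval_incidenceForm _ _ _
      simp only [h1, chartTrace, Set.mem_ofPred_eq, hY]
      rw [chartMatrix_map_eval,
        mem_specialSchubert_iff (hZ i.1) (finrank_rowSpace_chart hAk hAC _)]
      exact ⟨fun h _ => h, fun h => h ⟨0, Nat.one_pos⟩⟩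
  · refine linearIndependent_of_common_kernel ?_ _ fun v hv => ?_
    · have h1 : Fintype.card {i : Fin N // (i : ℕ) < α.size} = α.size := by
        refine (Fintype.card_congr (?_ : _ ≃ Fin α.size)).trans (Fintype.card_fin _)
        exact ⟨fun i => ⟨i.1, i.2⟩, fun i => ⟨⟨i, i.2.trans_le hα⟩, i.2⟩, fun _ => rfl, fun _ => rfl⟩
      rw [Fintype.card_sigma, Fintype.sum_option]
      simp only [c, Fintype.card_fin, Finset.sum_const, Finset.card_univ, h1, smul_eq_mul, mul_one,
        Fintype.card_prod]
      exact card_beyond_add_size α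
    · set M : Matrix (Fin k) (Fin n) ℂ := Matrix.of (fun i j => v (i, j)) * C with hM
      have hdual : ∀ i q, MvPolynomial.aeval (R := ℂ) (fun s =>
          (TrivSqZeroExt.inl ((0 : Fin k × Fin (n - k) → ℂ) s) + TrivSqZeroExt.inr (v s) :
            DualNumber ℂ)) (f i q) = 0 := by
        intro i q
        rw [aeval_dualNumber, hf0, hv ⟨i, q⟩, TrivSqZeroExt.inl_zero, TrivSqZeroExt.inr_zero,
          add_zero]
      -- A dual number is a unit once its reduction is, and here the reduction is `p_α(A)`.
      have hu : IsUnit (colMinor (dualMatrix A M) α.1) := by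
        rw [TrivSqZeroExt.isUnit_iff_isUnit_fst]
        have h1 := colMinor_map (TrivSqZeroExt.fstHom ℂ ℂ ℂ : DualNumber ℂ →+* ℂ)
          (dualMatrix A M) α.1
        have h2 : (dualMatrix A M).map (TrivSqZeroExt.fstHom ℂ ℂ ℂ : DualNumber ℂ →+* ℂ) = A := by
          ext i j
          exact fst_dualMatrix A M i j
        rw [h2] at h1
        exact isUnit_iff_ne_zero.2 fun h0 => hAα (h1.trans h0)
      obtain ⟨G, hG⟩ := hndA M ((inSchubert_iff_of_isUnit hu).2 fun p => by
          have h1 := hdual none (e.symm p)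
          simp only [f, Equiv.apply_symm_apply] at h1
          rw [← h1, ← chartMatrix_map_dual]
          exact colMinor_map _ _ _) fun s hs => by
          have h1 := hdual (some ⟨⟨s, hs.trans_le hα⟩, hs⟩) 0
          simp only [f] at h1
          rw [← h1, ← chartMatrix_map_dual]
          exact incidenceForm_map _ _ _
      have hCk : Module.finrank ℂ (rowSpace C) = n - k := by
        have := Submodule.finrank_add_eq_of_isCompl hAC
        rw [hAk, Module.finrank_fin_fun] at this
        omega
      funext ⟨i, j⟩
      have h1 : Matrix.vecMul (fun j => v (i, j)) C = M i := rfl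
      -- Nondegeneracy puts the rows of `M = X C` in the row space of `A`; they also lie in the
      -- complementary row space of `C`, so they vanish.
      have h2 : M i ∈ rowSpace A ⊓ rowSpace C := by
        refine ⟨?_, mem_rowSpace.2 ⟨_, h1⟩⟩
        rw [hG]
        exact mem_rowSpace.2 ⟨G i, rfl⟩
      rw [hAC.inf_eq_bot, Submodule.mem_bot] at h2
      exact congrFun ((vecMul_eq_zero_iff_of_finrank hCk).1 (h1.trans h2)) j

end Transversality

/-! ### The intersection as the set of normalized solutions. -/

section Solutions

variable {k n : ℕ}

lemma iInter_eq_image_normalizedSolutions {N : ℕ} {α : PluckerIndex k n} (hα : α.size ≤ N)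
    {Z : Fin N → Submodule ℂ (Fin n → ℂ)} {W : ℕ → Matrix (Fin n) (Fin k) ℂ}
    (hZ : ∀ (i : Fin N) z, z ∈ Z i ↔ Matrix.vecMul z (W i) = 0)
    {Y : Option {i : Fin N // (i : ℕ) < α.size} → Set (Submodule ℂ (Fin n → ℂ))}
    (hY0 : Y none = schubertVariety ℂ α) (hY : ∀ i, Y (some i) = specialSchubert k (Z i.1))
    (hno : ∀ β, β ⋖ α → HasNoExcessSolutions W β) :
    ⋂ i, Y i = rowSpace '' normalizedSolutions W α := by
  have key : ∀ B : Matrix (Fin k) (Fin n) ℂ, Module.finrank ℂ (rowSpace B) = k →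
      (rowSpace B ∈ ⋂ i, Y i ↔ InSchubert α B ∧ ∀ s < α.size, incidenceForm (W s) B = 0) := by
    intro B hB
    rw [Set.mem_iInter, Option.forall, hY0, mem_schubertVariety_iff α hB]
    refine and_congr_right fun _ => ⟨fun h s hs => ?_, fun h i => ?_⟩
    · have h1 := h ⟨⟨s, hs.trans_le hα⟩, hs⟩
      rw [hY] at h1
      exact (mem_specialSchubert_iff (hZ _) hB).1 h1
    · rw [hY]
      exact (mem_specialSchubert_iff (hZ _) hB).2 (h _ i.2)
  ext K
  constructor
  · intro hK
    have hKk : Module.finrank ℂ K = k := by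
      have h1 := Set.mem_iInter.1 hK none
      rw [hY0] at h1
      exact h1.1
    obtain ⟨B, rfl⟩ := exists_rowSpace_eq hKk
    obtain ⟨h1, h2⟩ := (key B hKk).1 hK
    have hne := colMinor_ne_zero_of_hasNoExcessSolutions hno (exists_colMinor_ne_zero hKk) h1 h2
    exact ⟨_, normalize_mem_normalizedSolutions hne h1 h2, rowSpace_normalize hne⟩
  · rintro ⟨B, hB, rfl⟩
    exact (key B (finrank_rowSpace_of_colMinor (γ := α)
      (by rw [colMinor_eq_one hB.1]; exact one_ne_zero))).2 hB.2

lemma injOn_rowSpace_normalizedSolutions (W : ℕ → Matrix (Fin n) (Fin k) ℂ)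
    (α : PluckerIndex k n) : Set.InjOn rowSpace (normalizedSolutions W α) := by
  intro B hB B' hB' h
  obtain ⟨P, rfl⟩ := exists_eq_mul_of_rowSpace_le h.le
  have h1 : (P * B').submatrix id α.1 = P * B'.submatrix id α.1 := rfl
  have h2 := hB.1
  rw [h1, hB'.1, Matrix.mul_one] at h2
  rw [h2, Matrix.one_mul]

end Solutions

end SchubertCalculus

/-! ### The theorem itself. -/

theorem theorem4p4 (k n : ℕ) (hkn : k ≤ n) (L : Submodule ℝ (Fin n → ℝ))
    (hL : L ∈ Gr ℝ (n - k) n)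
    (hPlucker : ∀ β : PluckerIndex (n - k) n, ¬ PluckerVanishes L β) :
    ∃ t : Fin (k * (n - k)) → ℝ, (∀ i, t i ≠ 0) ∧
      ∀ α : PluckerIndex k n,
        IsTransverse k (schubertFamily L t α) ∧
        (⋂ i, schubertFamily L t α i).encard = (chainCount α : ℕ∞) ∧
        ∀ K ∈ ⋂ i, schubertFamily L t α i, IsRealPlane K := by
  obtain ⟨Q, hQ⟩ := exists_equations hkn hL
  obtain ⟨t, ht, hreal, hno⟩ := exists_parameters hkn Q
    (fun γ => rowMinor_ne_zero hPlucker hQ γ) (k * (n - k))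
  refine ⟨fun i => t i, fun i => ht i, fun α => ?_⟩
  have hα := α.size_le
  have hgood := hreal α hα
  have hZ : ∀ (i : Fin (k * (n - k))) z, z ∈ complexify (L.map (weightScaling n (t i))) ↔
      Matrix.vecMul z (scaledEquations Q (t i : ℂ)) = 0 :=
    fun i z => mem_complexify_scaling_iff hQ (ht i) z
  have hint : ⋂ i, schubertFamily L (fun i : Fin (k * (n - k)) => t i) α i =
      rowSpace '' normalizedSolutions (fun s => scaledEquations Q (t s : ℂ)) α :=
    iInter_eq_image_normalizedSolutions hα hZ rfl (fun _ => rfl)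
      fun β hβ => hno β ((PluckerIndex.size_lt hβ.lt).trans_le hα)
  refine ⟨fun K hK => ?_, ?_, fun K hK => ?_⟩
  · rw [hint] at hK
    obtain ⟨B, hB, rfl⟩ := hK
    exact transverseAt_of_isNondegenerate hα hZ rfl (fun _ => rfl) hB (hgood.nondegenerate B hB)
  · rw [hint, (injOn_rowSpace_normalizedSolutions _ α).encard_image, ← hgood.ncard_eq,
      hgood.finite.cast_ncard_eq]
  · rw [hint] at hK
    obtain ⟨B, hB, rfl⟩ := hK
    exact isRealPlane_of_conj (hgood.real B hB)
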